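/- **Setting.** Let $(Y,X,Z)\sim P$, with $Y\in\mathbb R$, $X\in\mathbb R^d$ and $Z$ in an arbitrary measurable space; let $\widehat f$ be a fixed measurable real-valued function (the prediction algorithm), $\Theta\subseteq\mathbb R^q$, and $\psi(y,x;\theta)\in\mathbb R^q$ be measurable in $(y,x)$ for every $\theta\in\Theta$. The labeled data $(Y_i,X_i,Z_i)$, $i\ge1$, are i.i.d. from $P$; the unlabeled data $(\tilde X_j,\tilde Z_j)$, $j\ge 1$, are i.i.d. from the $(X,Z)$-marginal of $P$; the two samples are independent. Let $n=n_k\to\infty$ and $N=N_k\to\infty$ as $k\to\infty$, with $n/N\to\rho\in[0,\infty)$. For $w\in\mathbb R^q$ put $$\Psi^{w}(\theta)=\frac1n\sum_{i=1}^n\psi(Y_i,X_i;\theta)+\operatorname{diag}(w)\Big\{-\frac1n\sum_{i=1}^n\psi(\widehat f(Z_i),X_i;\theta)+\frac1N\sum_{j=1}^{N}\psi(\widehat f(\tilde Z_j),\tilde X_j;\theta)\Big\}.$$ Let $\omega\in\mathbb R^q$ be fixed, let $\widehat\omega=\widehat\omega_k$ be random vectors with $\widehat\omega\to_P\omega$,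 and let $\widehat\theta=\widehat\theta_{\mathrm{PSPA}}(\widehat\omega)$ be a random vector which, almost surely, is a zero of $\Psi^{\widehat\omega}$ in $\Theta$ whenever there is one. **Conditions.** - (C1) $\Theta$ is compact and $\theta_0\in\Theta$ is the only solution in $\Theta$ of $\mathbb E\,\psi(Y,X;\theta)=0$. - (C2) With probability tending to one, $\Psi^{\widehat\omega}$ is continuous on $\Theta$ and has exactly one zero in $\Theta$. - (C3) $\sup_{\theta\in\Theta}\mathbb E\|\psi(Y,X;\theta)\|^2<\infty$ and $\sup_{\theta\in\Theta}\mathbb E\|\operatorname{diag}(\omega)\psi(\widehat f(Z),X;\theta)\|^2<\infty$. - (C4) The data are sampled as described in the setting. - (D) Almost surely $\psi(Y,X;\cdot)$ and $\psi(\widehat f(Z),X;\cdot)$ are continuous on $\Theta$, and their norms are dominated, uniformly over $\Theta$, by integrable functions of the data point. - (C5) There is an open neighbourhood $B\subseteq\Theta$ of $\theta_0$ on which, almost surely, $\psi(Y,X;\cdot)$ and $\psi(\widehat f(Z),X;\cdot)$ are continuously differentiable, and the norms of the derivatives are dominated, uniformly over $B$, by integrable functions of the data point. The matrix $A=\mathbb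 E[\partial\psi(Y,X;\theta_0)/\partial\theta]$ is nonsingular. Moreover $\mathbb E\|\psi(\widehat f(Z),X;\theta_0)\|^2<\infty$. **Claim.** Assume (C1)–(C4). 1. If (D) holds, then $\widehat\theta\to_P\theta_0$. 2. If (C5) holds, then $\widehat\theta\to_P\theta_0$ as well, the matrix $\Sigma(\omega)$ below is positive semidefinite, and $$\sqrt n\,(\widehat\theta-\theta_0)\to_D\mathcal N(0,\Sigma(\omega)),\qquad \Sigma(\omega)=A^{-1}V(\omega)A^{-\mathsf T},$$ $$V(\omega)=M_1+\operatorname{diag}(\omega)(M_2+\rho M_3)\operatorname{diag}(\omega)-\operatorname{diag}(\omega)M_4^{\mathsf T}-M_4\operatorname{diag}(\omega),$$ where $M_1=\operatorname{Var}[\psi(Y,X;\theta_0)]$, $M_2=\operatorname{Var}[\psi(\widehat f(Z),X;\theta_0)]$ for a labeled observation, $M_3=\operatorname{Var}[\psi(\widehat f(\tilde Z),\tilde X;\theta_0)]$ for an unlabeled observation, and $M_4=\operatorname{Cov}[\psi(Y,X;\theta_0),\psi(\widehat f(Z),X;\theta_0)]$. -/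

import Mathlib

open MeasureTheory ProbabilityTheory Filter
open scoped Topology ENNReal

noncomputable section

namespace PSPA

/-- `ℝᵐ` with the Euclidean norm. -/
abbrev Vec (m : ℕ) : Type := EuclideanSpace ℝ (Fin m)

/-- The product `diag(w) v`. -/
def diagMul {q : ℕ} (w v : Vec q) : Vec q := WithLp.toLp 2 (fun j => w j * v j)

/-- The score `ψ(y, x; θ)` with the true outcome, as a function of a labeled point `(y, x, z)`. -/
def scoreY {d q : ℕ} {Z : Type*} (ψ : ℝ → Vec d → Vec q → Vec q) (θ : Vec q)
    (p : ℝ × Vec d × Z) : Vec q :=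
  ψ p.1 p.2.1 θ

/-- The score `ψ(f(z), x; θ)` with the predicted outcome, as a function of `(x, z)`. -/
def scoreF {d q : ℕ} {Z : Type*} (ψ : ℝ → Vec d → Vec q → Vec q) (f : Z → ℝ) (θ : Vec q)
    (p : Vec d × Z) : Vec q :=
  ψ (f p.2) p.1 θ

/-- The PSPA estimating function with weighting vector `w` at `θ`, based on the labeled points
`l 0, …, l (n - 1)` and the unlabeled points `u 0, …, u (N - 1)`. -/
def estFun {d q : ℕ} {Z : Type*} (ψ : ℝ → Vec d → Vec q → Vec q) (f : Z → ℝ)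
    (n N : ℕ) (l : ℕ → ℝ × Vec d × Z) (u : ℕ → Vec d × Z) (w θ : Vec q) : Vec q :=
  (n : ℝ)⁻¹ • ∑ i ∈ Finset.range n, scoreY ψ θ (l i)
    + diagMul w (-((n : ℝ)⁻¹ • ∑ i ∈ Finset.range n, scoreF ψ f θ (l i).2)
        + (N : ℝ)⁻¹ • ∑ j ∈ Finset.range N, scoreF ψ f θ (u j))

/-- The (cross-)covariance matrix `Cov[U, V]` of two random vectors under `P`. -/
def covMatrix {q : ℕ} {S : Type*} [MeasurableSpace S] (P : Measure S) (U V : S → Vec q) :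
    Matrix (Fin q) (Fin q) ℝ :=
  Matrix.of fun i j => cov[fun s => U s i, fun s => V s j; P]

section Population

variable {d q : ℕ} {Z : Type*} [MeasurableSpace Z]

/-- `A = E[∂ψ(Y, X; θ)/∂θ]`, with `(i, j)` entry `E[∂ψᵢ/∂θⱼ]`. -/
def matA (P : Measure (ℝ × Vec d × Z)) (ψ : ℝ → Vec d → Vec q → Vec q) (θ : Vec q) :
    Matrix (Fin q) (Fin q) ℝ :=
  Matrix.of fun i j =>
    ∫ p, (fderiv ℝ (fun t => scoreY ψ t p) θ (EuclideanSpace.single j 1)) i ∂P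

/-- `M₁ = Var[ψ(Y, X; θ)]`. -/
def matM1 (P : Measure (ℝ × Vec d × Z)) (ψ : ℝ → Vec d → Vec q → Vec q) (θ : Vec q) :
    Matrix (Fin q) (Fin q) ℝ :=
  covMatrix P (scoreY ψ θ) (scoreY ψ θ)

/-- `M₂ = Var[ψ(f(Z), X; θ)]`, for a labeled observation. -/
def matM2 (P : Measure (ℝ × Vec d × Z)) (ψ : ℝ → Vec d → Vec q → Vec q) (f : Z → ℝ)
    (θ : Vec q) : Matrix (Fin q) (Fin q) ℝ :=
  covMatrix P (fun p => scoreF ψ f θ p.2) (fun p => scoreF ψ f θ p.2)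

/-- `M₃ = Var[ψ(f(Z), X; θ)]`, for an unlabeled observation. -/
def matM3 (P : Measure (ℝ × Vec d × Z)) (ψ : ℝ → Vec d → Vec q → Vec q) (f : Z → ℝ)
    (θ : Vec q) : Matrix (Fin q) (Fin q) ℝ :=
  covMatrix (P.map Prod.snd) (scoreF ψ f θ) (scoreF ψ f θ)

/-- `M₄ = Cov[ψ(Y, X; θ), ψ(f(Z), X; θ)]`. -/
def matM4 (P : Measure (ℝ × Vec d × Z)) (ψ : ℝ → Vec d → Vec q → Vec q) (f : Z → ℝ)
    (θ : Vec q) : Matrix (Fin q) (Fin q) ℝ :=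
  covMatrix P (scoreY ψ θ) (fun p => scoreF ψ f θ p.2)

/-- `V(w) = M₁ + diag(w) (M₂ + ρ M₃) diag(w) - (diag(w) M₄ᵀ + M₄ diag(w))`. -/
def matV (P : Measure (ℝ × Vec d × Z)) (ψ : ℝ → Vec d → Vec q → Vec q) (f : Z → ℝ) (ρ : ℝ)
    (w θ : Vec q) : Matrix (Fin q) (Fin q) ℝ :=
  matM1 P ψ θ
    + Matrix.diagonal w.ofLp * (matM2 P ψ f θ + ρ • matM3 P ψ f θ) * Matrix.diagonal w.ofLp
    - (Matrix.diagonal w.ofLp * (matM4 P ψ f θ).transpose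
        + matM4 P ψ f θ * Matrix.diagonal w.ofLp)

/-- The asymptotic covariance `Σ(w) = A⁻¹ V(w) A⁻ᵀ`. -/
def matSigma (P : Measure (ℝ × Vec d × Z)) (ψ : ℝ → Vec d → Vec q → Vec q) (f : Z → ℝ) (ρ : ℝ)
    (w θ : Vec q) : Matrix (Fin q) (Fin q) ℝ :=
  (matA P ψ θ)⁻¹ * matV P ψ f ρ w θ * ((matA P ψ θ)⁻¹).transpose

/-- The parameter space is compact and `θ₀` is the only solution in it of
`E[ψ(Y, X; θ)] = 0`. -/
structure TrueParameter (P : Measure (ℝ × Vec d × Z)) (ψ : ℝ → Vec d → Vec q → Vec q)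
    (Θ : Set (Vec q)) (θ₀ : Vec q) : Prop where
  compact : IsCompact Θ
  mem : θ₀ ∈ Θ
  unique : ∀ θ ∈ Θ, ∫ p, scoreY ψ θ p ∂P = 0 ↔ θ = θ₀

/-- Square-integrability of the scores, uniformly over the parameter space. -/
structure SecondMoments (P : Measure (ℝ × Vec d × Z)) (ψ : ℝ → Vec d → Vec q → Vec q)
    (f : Z → ℝ) (Θ : Set (Vec q)) (w : Vec q) : Prop where
  outcome : ⨆ θ ∈ Θ, ∫⁻ p, ‖scoreY ψ θ p‖ₑ ^ 2 ∂P < ∞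
  predicted : ⨆ θ ∈ Θ, ∫⁻ p, ‖diagMul w (scoreF ψ f θ p.2)‖ₑ ^ 2 ∂P < ∞

/-- The scores are almost surely continuous in the parameter and dominated by an integrable
function, over the whole parameter space. -/
structure Dominated (P : Measure (ℝ × Vec d × Z)) (ψ : ℝ → Vec d → Vec q → Vec q)
    (f : Z → ℝ) (Θ : Set (Vec q)) : Prop where
  continuous_outcome : ∀ᵐ p ∂P, ContinuousOn (fun θ => scoreY ψ θ p) Θ
  continuous_predicted : ∀ᵐ v ∂(P.map Prod.snd), ContinuousOn (fun θ => scoreF ψ f θ v) Θ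
  envelope_outcome : ∃ h : ℝ × Vec d × Z → ℝ, Integrable h P ∧
    ∀ᵐ p ∂P, ∀ θ ∈ Θ, ‖scoreY ψ θ p‖ ≤ h p
  envelope_predicted : ∃ h : Vec d × Z → ℝ, Integrable h (P.map Prod.snd) ∧
    ∀ᵐ v ∂(P.map Prod.snd), ∀ θ ∈ Θ, ‖scoreF ψ f θ v‖ ≤ h v

/-- Local regularity at `θ₀`: on an open neighbourhood of `θ₀` inside the parameter space the
scores are almost surely continuously differentiable, with derivatives dominated by integrable
functions, and `A = E[∂ψ/∂θ]` is nonsingular at `θ₀`. The score with the predicted outcome is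
square-integrable at `θ₀`, so that `M₂`, `M₃`, `M₄` are defined. -/
structure LocallySmooth (P : Measure (ℝ × Vec d × Z)) (ψ : ℝ → Vec d → Vec q → Vec q)
    (f : Z → ℝ) (Θ : Set (Vec q)) (θ₀ : Vec q) : Prop where
  exists_nhd : ∃ B : Set (Vec q), IsOpen B ∧ θ₀ ∈ B ∧ B ⊆ Θ ∧
    (∀ᵐ p ∂P, ContDiffOn ℝ 1 (fun θ => scoreY ψ θ p) B) ∧
    (∀ᵐ v ∂(P.map Prod.snd), ContDiffOn ℝ 1 (fun θ => scoreF ψ f θ v) B) ∧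
    (∃ h : ℝ × Vec d × Z → ℝ, Integrable h P ∧
      ∀ᵐ p ∂P, ∀ θ ∈ B, ‖fderiv ℝ (fun t => scoreY ψ t p) θ‖ ≤ h p) ∧
    (∃ h : Vec d × Z → ℝ, Integrable h (P.map Prod.snd) ∧
      ∀ᵐ v ∂(P.map Prod.snd), ∀ θ ∈ B, ‖fderiv ℝ (fun t => scoreF ψ f t v) θ‖ ≤ h v)
  nonsingular : IsUnit (matA P ψ θ₀).det
  memLp_predicted : MemLp (scoreF ψ f θ₀) 2 (P.map Prod.snd)

variable {Ω : Type*} [MeasurableSpace Ω]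

/-- The labeled points `L i` are i.i.d. from the population `P` of `(Y, X, Z)`, the unlabeled
points `U j` are i.i.d. from its `(X, Z)`-marginal, and the two samples are independent. -/
structure IIDSamples (μ : Measure Ω) (P : Measure (ℝ × Vec d × Z))
    (L : ℕ → Ω → ℝ × Vec d × Z) (U : ℕ → Ω → Vec d × Z) : Prop where
  law_labeled : ∀ i, HasLaw (L i) P μ
  law_unlabeled : ∀ j, HasLaw (U j) (P.map Prod.snd) μ
  indep_labeled : iIndepFun L μ
  indep_unlabeled : iIndepFun U μ
  indep_samples : IndepFun (fun ω i => L i ω) (fun ω j => U j ω) μ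

/-- With probability tending to one, the PSPA estimating function with the weights `W k`,
based on `n k` labeled and `N k` unlabeled points, is continuous on the parameter space and has
exactly one zero there. -/
def WellPosed (μ : Measure Ω) (ψ : ℝ → Vec d → Vec q → Vec q) (f : Z → ℝ) (Θ : Set (Vec q))
    (n N : ℕ → ℕ) (L : ℕ → Ω → ℝ × Vec d × Z) (U : ℕ → Ω → Vec d × Z)
    (W : ℕ → Ω → Vec q) : Prop :=
  Tendsto (fun k => μ {ω | ¬ (
      ContinuousOn (estFun ψ f (n k) (N k) (fun i => L i ω) (fun j => U j ω) (W k ω)) Θ ∧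
      ∃! θ, θ ∈ Θ ∧
        estFun ψ f (n k) (N k) (fun i => L i ω) (fun j => U j ω) (W k ω) θ = 0)})
    atTop (𝓝 0)

/-- `θhat k` is the PSPA estimator with the weights `W k`, based on `n k` labeled and `N k`
unlabeled points: almost surely, it is a zero in the parameter space of the PSPA estimating
function whenever there is one. -/
def IsEstimator (μ : Measure Ω) (ψ : ℝ → Vec d → Vec q → Vec q) (f : Z → ℝ) (Θ : Set (Vec q))
    (n N : ℕ → ℕ) (L : ℕ → Ω → ℝ × Vec d × Z) (U : ℕ → Ω → Vec d × Z)
    (W θhat : ℕ → Ω → Vec q) : Prop :=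
  ∀ k, ∀ᵐ ω ∂μ,
    (∃ θ ∈ Θ, estFun ψ f (n k) (N k) (fun i => L i ω) (fun j => U j ω) (W k ω) θ = 0) →
      θhat k ω ∈ Θ ∧
        estFun ψ f (n k) (N k) (fun i => L i ω) (fun j => U j ω) (W k ω) (θhat k ω) = 0

end Population

end PSPA

end

set_option linter.unusedSectionVars false

/-! Write Ψ for the estimating function. Its two averages of predicted scores have the same mean, so
their difference, and near θ₀ the difference of their increments, is negligible in the limit. The
weights are bounded in probability, hence Ψ behaves like the average of ψ(Y, X; θ) alone; the
weights only affect the variance.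

Under (D), dominated convergence gives a law of large numbers that is uniform on a small ball about
each θ. So Ψ stays away from 0 near every θ ≠ θ₀ (`exists_highProb_estFun_ne_zero`), and compactness
of Θ leaves zeros only near θ₀.

Under (C5) domination is local, and distant zeros cannot be excluded in this way. Instead, on a
small ball about θ₀ the function Ψ is affine with linear part A, up to a small Lipschitz error
(`exists_highProb_estFun_sub_sub_le`). As A is invertible and Ψ(θ₀) → 0 in probability, Ψ has a zero
in that ball, and uniqueness in (C2) forces it to be the estimator (`highProb_estimator_expansion`).
This yields both consistency and √n(θhat − θ₀) = −A⁻¹√nΨ(θ₀) + o_P(1). Replacing the estimated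
weights by their limit changes √nΨ(θ₀) by diag(what − w) times a sequence bounded in probability.
The central limit theorem for two independent samples (`tendstoInDistribution_twoSample`) concludes.
The quadratic form of Σ is a nonnegative combination of two variances, which identifies the limit
and shows that Σ is positive semidefinite. -/

namespace PSPA

/-! ### Events of probability tending to one -/

section HighProbability

variable {Ω : Type*} [MeasurableSpace Ω] {μ : Measure Ω}

/-- The events `E k` hold with probability tending to one. -/
def HighProb (μ : Measure Ω) (E : ℕ → Ω → Prop) : Prop :=
  Tendsto (fun k => μ {ω | ¬ E k ω}) atTop (𝓝 0)

/-- The events need not be measurable: only monotonicity and subadditivity of the outer measure are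
used in this calculus. -/
lemma HighProb.mono_ae {E F : ℕ → Ω → Prop} (hE : HighProb μ E)
    (h : ∀ᶠ k in atTop, ∀ᵐ ω ∂μ, E k ω → F k ω) : HighProb μ F := by
  refine tendsto_of_tendsto_of_tendsto_of_le_of_le' tendsto_const_nhds hE
    (Eventually.of_forall fun _ => zero_le) ?_
  filter_upwards [h] with k hk
  refine measure_mono_ae ?_
  filter_upwards [hk] with ω hω hF
  exact fun hE' => hF (hω hE')

lemma HighProb.mono {E F : ℕ → Ω → Prop} (hE : HighProb μ E)
    (h : ∀ k ω, E k ω → F k ω) : HighProb μ F :=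
  hE.mono_ae (Eventually.of_forall fun k => Eventually.of_forall (h k))

lemma HighProb.and {E F : ℕ → Ω → Prop} (hE : HighProb μ E) (hF : HighProb μ F) :
    HighProb μ (fun k ω => E k ω ∧ F k ω) := by
  have h := hE.add hF
  rw [add_zero] at h
  refine tendsto_of_tendsto_of_tendsto_of_le_of_le tendsto_const_nhds h
    (fun _ => zero_le) fun k => ?_
  refine (measure_mono fun ω hω => ?_).trans (measure_union_le _ _)
  simp only [Set.mem_ofPred_eq, Set.mem_union] at hω ⊢
  tauto

lemma highProb_of_ae {E : ℕ → Ω → Prop} (h : ∀ k, ∀ᵐ ω ∂μ, E k ω) : HighProb μ E := by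
  have : (fun k => μ {ω | ¬ E k ω}) = fun _ => 0 := funext fun k => ae_iff.1 (h k)
  rw [HighProb, this]
  exact tendsto_const_nhds

/-- Turns convergence in probability into events, so that later estimates can be made pointwise in
ω. -/
lemma tendstoInMeasure_iff_highProb {E : Type*} [PseudoMetricSpace E] {f : ℕ → Ω → E}
    {g : Ω → E} :
    TendstoInMeasure μ f atTop g ↔
      ∀ ε, 0 < ε → HighProb μ (fun k ω => dist (f k ω) (g ω) < ε) := by
  simp only [tendstoInMeasure_iff_dist, HighProb, not_lt]

end HighProbability

/-! ### Laws of large numbers for averages -/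

section Averages

variable {Ω S E : Type*} [MeasurableSpace Ω] [MeasurableSpace S] {μ : Measure Ω}
  [IsProbabilityMeasure μ] {Q : Measure S} [IsProbabilityMeasure Q] {X : ℕ → Ω → S}
  {m : ℕ → ℕ}

/-- The average of `g` over the first `m` points of the sequence `x`. -/
noncomputable def average [AddCommGroup E] [Module ℝ E] (m : ℕ) (x : ℕ → S) (g : S → E) : E :=
  (m : ℝ)⁻¹ • ∑ i ∈ Finset.range m, g (x i)

lemma ae_of_hasLaw {X : Ω → S} (hX : HasLaw X Q μ) {p : S → Prop} (h : ∀ᵐ x ∂Q, p x) :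
    ∀ᵐ ω ∂μ, p (X ω) :=
  ae_of_ae_map hX.aemeasurable (hX.map_eq.symm ▸ h)

lemma ae_forall_of_hasLaw (hX : ∀ i, HasLaw (X i) Q μ) {p : S → Prop} (h : ∀ᵐ x ∂Q, p x) :
    ∀ᵐ ω ∂μ, ∀ i, p (X i ω) :=
  ae_all_iff.2 fun i => ae_of_hasLaw (hX i) h

/-- The weak law of large numbers along a sequence of sample sizes. -/
lemma tendstoInMeasure_average [NormedAddCommGroup E] [NormedSpace ℝ E] [CompleteSpace E]
    [MeasurableSpace E] [BorelSpace E] (hX : ∀ i, HasLaw (X i) Q μ) (hind : iIndepFun X μ)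
    (hm : Tendsto m atTop atTop) {g : S → E} (hg : Integrable g Q) :
    TendstoInMeasure μ (fun k ω => average (m k) (fun i => X i ω) g) atTop
      (fun _ => ∫ p, g p ∂Q) := by
  -- Independence passes to compositions with genuinely measurable maps, so the strong law is
  -- applied to a measurable version of `g`; almost surely the two agree at all sample points.
  set g' := hg.aestronglyMeasurable.mk g with hg'
  have hgm : StronglyMeasurable g' := hg.aestronglyMeasurable.stronglyMeasurable_mk
  have hae : g =ᵐ[Q] g' := hg.aestronglyMeasurable.ae_eq_mk
  have hg'i : Integrable g' Q := hg.congr hae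
  have hlaw : ∀ i, HasLaw (g' ∘ X i) (Q.map g') μ := fun i =>
    HasLaw.comp ⟨hgm.measurable.aemeasurable, rfl⟩ (hX i)
  have hint : ∫ ω, (g' ∘ X 0) ω ∂μ = ∫ p, g p ∂Q := by
    rw [(hX 0).integral_comp hgm.aestronglyMeasurable]
    exact integral_congr_ae hae.symm
  have key := strong_law_ae (μ := μ) (fun i => g' ∘ X i)
    ((hX 0).map_eq.symm ▸ hg'i |>.comp_aemeasurable (hX 0).aemeasurable)
    (fun i j hij => (hind.indepFun hij).comp hgm.measurable hgm.measurable)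
    (fun i => ⟨(hlaw i).aemeasurable, (hlaw 0).aemeasurable, by
      rw [(hlaw i).map_eq, (hlaw 0).map_eq]⟩)
  rw [hint] at key
  have hEq := ae_forall_of_hasLaw hX hae
  refine tendstoInMeasure_of_tendsto_ae (fun k => ?_) ?_
  · refine AEStronglyMeasurable.const_smul (Finset.aestronglyMeasurable_fun_sum _ fun i _ => ?_) _
    exact ((hX i).map_eq.symm ▸ hg.aestronglyMeasurable).comp_aemeasurable (hX i).aemeasurable
  · filter_upwards [key, hEq] with ω hω hE
    refine (hω.comp hm).congr fun k => ?_
    simp only [Function.comp, average]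
    congr 1
    exact Finset.sum_congr rfl fun i _ => (hE i).symm

lemma norm_average_le [SeminormedAddCommGroup E] [NormedSpace ℝ E] {n : ℕ} {x : ℕ → S}
    {g : S → E} {h : S → ℝ} (hgh : ∀ i, ‖g (x i)‖ ≤ h (x i)) :
    ‖average n x g‖ ≤ average n x h := by
  simp only [average, norm_smul, norm_inv, Real.norm_natCast, smul_eq_mul]
  gcongr
  exact (norm_sum_le _ _).trans (Finset.sum_le_sum fun i _ => hgh i)

/-- A dominated family whose oscillation over shrinking index sets vanishes almost surely has
uniformly small averages. The suprema are determined by countable subsets. -/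
lemma highProb_norm_average_le {T : Type*} [NormedAddCommGroup E] [NormedSpace ℝ E]
    (hX : ∀ i, HasLaw (X i) Q μ) (hind : iIndepFun X μ) (hm : Tendsto m atTop atTop)
    {G : T → S → E} {A C : ℕ → Set T} {h : S → ℝ} (hh : Integrable h Q)
    (hC : ∀ j, (C j).Countable) (hCA : ∀ j, C j ⊆ A j)
    (hmeas : ∀ j, ∀ t ∈ C j, AEStronglyMeasurable (G t) Q)
    (hdet : ∀ᵐ p ∂Q, ∀ j, ∀ t ∈ A j, ∀ b, (∀ c ∈ C j, ‖G c p‖ ≤ b) → ‖G t p‖ ≤ b)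
    (hdom : ∀ᵐ p ∂Q, ∀ j, ∀ t ∈ A j, ‖G t p‖ ≤ h p)
    (hlim : ∀ᵐ p ∂Q, ∀ ε > 0, ∀ᶠ j in atTop, ∀ t ∈ A j, ‖G t p‖ ≤ ε) {ε : ℝ} (hε : 0 < ε) :
    ∃ j, HighProb μ (fun k ω => ∀ t ∈ A j, ‖average (m k) (fun i => X i ω) (G t)‖ ≤ ε) := by
  -- The envelope over a countable set is measurable, and in `ℝ≥0∞` it exists without boundedness.
  -- Its integral tends to 0 by dominated convergence; once it is below `ε` for some `j`, the law of
  -- large numbers for this single function controls all the averages at once.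
  set g : ℕ → S → ℝ≥0∞ := fun j p => ⨆ c ∈ C j, ‖G c p‖ₑ with hg
  have hgm : ∀ j, AEMeasurable (g j) Q := fun j =>
    AEMeasurable.biSup _ (hC j) fun c hc => (hmeas j c hc).enorm
  have hgle : ∀ j p b, (∀ c ∈ C j, ‖G c p‖ ≤ b) → g j p ≤ ENNReal.ofReal b := by
    intro j p b hb
    refine iSup₂_le fun c hc => ?_
    rw [← ofReal_norm]
    exact ENNReal.ofReal_le_ofReal (hb c hc)
  have hgr : ∀ j p b, 0 ≤ b → (∀ c ∈ C j, ‖G c p‖ ≤ b) → (g j p).toReal ≤ b :=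
    fun j p b hb0 hb => ENNReal.toReal_le_of_le_ofReal hb0 (hgle j p b hb)
  have hgdom : ∀ j, ∀ᵐ p ∂Q, ‖(g j p).toReal‖ ≤ |h p| := by
    intro j
    filter_upwards [hdom] with p hp
    rw [Real.norm_of_nonneg ENNReal.toReal_nonneg]
    exact hgr j p _ (abs_nonneg _) fun c hc => (hp j c (hCA j hc)).trans (le_abs_self _)
  have hglim : ∀ᵐ p ∂Q, Tendsto (fun j => (g j p).toReal) atTop (𝓝 0) := by
    filter_upwards [hlim] with p hp
    refine Metric.tendsto_nhds.2 fun ε hε => ?_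
    filter_upwards [hp (ε / 2) (by positivity)] with j hj
    rw [Real.dist_eq, sub_zero, abs_of_nonneg ENNReal.toReal_nonneg]
    have := hgr j p _ (by positivity) fun c hc => hj c (hCA j hc)
    linarith
  have hint := tendsto_integral_of_dominated_convergence (μ := Q) (fun p => |h p|)
    (fun j => (hgm j).ennreal_toReal.aestronglyMeasurable) hh.abs hgdom hglim
  rw [integral_zero] at hint
  obtain ⟨j, hj⟩ := (hint.eventually (gt_mem_nhds hε)).exists
  refine ⟨j, ?_⟩
  have hgi : Integrable (fun p => (g j p).toReal) Q :=
    Integrable.mono' hh.abs (hgm j).ennreal_toReal.aestronglyMeasurable (hgdom j)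
  have hL := tendstoInMeasure_iff_highProb.1 (tendstoInMeasure_average hX hind hm hgi)
    (ε - ∫ p, (g j p).toReal ∂Q) (by linarith)
  refine hL.mono_ae (Eventually.of_forall fun k => ?_)
  filter_upwards [ae_forall_of_hasLaw hX hdet, ae_forall_of_hasLaw hX hdom] with ω h1 h2 h3 t ht
  have hav : ‖average (m k) (fun i => X i ω) (G t)‖
      ≤ average (m k) (fun i => X i ω) (fun p => (g j p).toReal) := by
    refine norm_average_le fun i => h1 i j t ht _ fun c hc => ?_
    have hfin : g j (X i ω) ≠ ∞ := ne_top_of_le_ne_top ENNReal.ofReal_ne_top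
      (hgle j (X i ω) _ fun c hc => h2 i j c (hCA j hc))
    rw [← toReal_enorm]
    exact ENNReal.toReal_mono hfin (le_iSup₂ (f := fun c _ => ‖G c (X i ω)‖ₑ) c hc)
  rw [Real.dist_eq] at h3
  linarith [le_abs_self (average (m k) (fun i => X i ω) (fun p => (g j p).toReal)
    - ∫ p, (g j p).toReal ∂Q)]

end Averages

/-! ### Uniform laws of large numbers and derivatives -/

section Regularity

variable {Ω S V E : Type*} [MeasurableSpace Ω] [MeasurableSpace S] {μ : Measure Ω}
  [IsProbabilityMeasure μ] {Q : Measure S} [IsProbabilityMeasure Q] {X : ℕ → Ω → S}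
  {m : ℕ → ℕ}
  [NormedAddCommGroup V] [NormedSpace ℝ V] [FiniteDimensional ℝ V]
  [NormedAddCommGroup E] [NormedSpace ℝ E] [FiniteDimensional ℝ E]
  [MeasurableSpace E] [BorelSpace E]

/-- A norm bound is a closed condition, so continuity carries it over from a dense subset. This
reduces suprema over balls to countable ones. -/
lemma norm_le_of_forall_mem_dense {T : Type*} [TopologicalSpace T] {A C : Set T} {g : T → E}
    (hg : ContinuousOn g A) (hCA : C ⊆ A) (hAC : A ⊆ closure C) {b : ℝ}
    (hb : ∀ c ∈ C, ‖g c‖ ≤ b) {t : T} (ht : t ∈ A) : ‖g t‖ ≤ b := by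
  have h1 : ContinuousWithinAt g C t := (hg t ht).mono hCA
  have h2 := h1.mem_closure (t := {y | ‖y‖ ≤ b}) (hAC ht) fun c hc => hb c hc
  rwa [(isClosed_le continuous_norm continuous_const).closure_eq] at h2

/-- A local uniform law of large numbers at a point `θ` of the set `Θ`. -/
lemma exists_highProb_norm_average_sub_integral_le (hX : ∀ i, HasLaw (X i) Q μ)
    (hind : iIndepFun X μ) (hm : Tendsto m atTop atTop) {s : V → S → E} {Θ : Set V}
    (hs : ∀ θ ∈ Θ, AEStronglyMeasurable (s θ) Q)
    (hcont : ∀ᵐ p ∂Q, ContinuousOn (fun θ => s θ p) Θ)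
    (hdom : ∃ h : S → ℝ, Integrable h Q ∧ ∀ᵐ p ∂Q, ∀ θ ∈ Θ, ‖s θ p‖ ≤ h p)
    {θ : V} (hθ : θ ∈ Θ) {ε : ℝ} (hε : 0 < ε) :
    ∃ r > 0, HighProb μ (fun k ω => ∀ t ∈ Θ ∩ Metric.ball θ r,
      ‖average (m k) (fun i => X i ω) (s t) - ∫ p, s θ p ∂Q‖ ≤ ε) := by
  obtain ⟨h, hh, hsh⟩ := hdom
  set A : ℕ → Set V := fun j => Θ ∩ Metric.ball θ (1 / ((j : ℝ) + 1)) with hA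
  have hsep : ∀ j, ∃ c ⊆ A j, c.Countable ∧ A j ⊆ closure c := fun j =>
    (TopologicalSpace.IsSeparable.of_separableSpace (A j)).exists_countable_dense_subset
  choose C hCA hC hAC using hsep
  have hsθ : Integrable (s θ) Q := Integrable.mono' hh (hs θ hθ) (hsh.mono fun p hp => hp θ hθ)
  -- The increments from the centre `θ` vanish uniformly on shrinking balls by continuity at `θ`.
  -- They take half of `ε`, the law of large numbers at `θ` itself the other half.
  obtain ⟨j, hj⟩ := highProb_norm_average_le (G := fun t p => s t p - s θ p) (A := A) (C := C)
    (h := fun p => h p + h p) hX hind hm (hh.add hh) hC hCA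
    (fun j t ht => (hs t (hCA j ht).1).sub (hs θ hθ))
    (by
      filter_upwards [hcont] with p hp j t ht b hb
      exact norm_le_of_forall_mem_dense (g := fun t => s t p - s θ p)
        ((hp.mono Set.inter_subset_left).sub continuousOn_const) (hCA j) (hAC j) hb ht)
    (by
      filter_upwards [hsh] with p hp j t ht
      exact (norm_sub_le _ _).trans (add_le_add (hp t ht.1) (hp θ hθ)))
    (by
      filter_upwards [hcont] with p hp ε hε
      obtain ⟨δ, hδ, hd⟩ := Metric.continuousWithinAt_iff.1 (hp θ hθ) ε hε
      obtain ⟨j₀, hj₀⟩ := exists_nat_one_div_lt hδ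
      filter_upwards [eventually_ge_atTop j₀] with j hj t ht
      rw [← dist_eq_norm]
      refine (hd ht.1 (ht.2.trans_le (le_trans ?_ hj₀.le))).le
      gcongr)
    (half_pos hε)
  refine ⟨1 / ((j : ℝ) + 1), by positivity, ?_⟩
  have hL := tendstoInMeasure_iff_highProb.1 (tendstoInMeasure_average hX hind hm hsθ)
    (ε / 2) (half_pos hε)
  refine (hj.and hL).mono fun k ω ⟨h1, h2⟩ t ht => ?_
  have h3 := h1 t ht
  rw [dist_eq_norm] at h2
  have h4 : average (m k) (fun i => X i ω) (s t) - ∫ p, s θ p ∂Q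
      = average (m k) (fun i => X i ω) (fun p => s t p - s θ p)
        + (average (m k) (fun i => X i ω) (s θ) - ∫ p, s θ p ∂Q) := by
    simp only [average, Finset.sum_sub_distrib, smul_sub]
    abel
  rw [h4]
  exact (norm_add_le _ _).trans (by linarith)

/-- The derivative at a point of a random differentiable function is measurable. -/
lemma aestronglyMeasurable_fderiv {s : V → S → E} {B : Set V} (hB : IsOpen B) {θ : V}
    (hθ : θ ∈ B) (hs : ∀ t ∈ B, AEStronglyMeasurable (s t) Q)
    (hd : ∀ᵐ p ∂Q, DifferentiableAt ℝ (fun t => s t p) θ) :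
    AEStronglyMeasurable (fun p => fderiv ℝ (fun t => s t p) θ) Q := by
  have hdir : ∀ v : V, AEStronglyMeasurable (fun p => fderiv ℝ (fun t => s t p) θ v) Q := by
    intro v
    have hlim : Tendsto (fun j : ℕ => θ + ((j : ℝ) + 1)⁻¹ • v) atTop (𝓝 θ) := by
      have := (tendsto_one_div_add_atTop_nhds_zero_nat (𝕜 := ℝ)).smul_const v |>.const_add θ
      simpa using this
    -- Directional derivatives are limits of difference quotients; the shift by `j₀` keeps all the
    -- points in `B`, where `s` is measurable.
    obtain ⟨j₀, hj₀⟩ := eventually_atTop.1 (hlim.eventually (hB.mem_nhds hθ))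
    refine aestronglyMeasurable_of_tendsto_ae (u := atTop)
      (f := fun (j : ℕ) p => (((j + j₀ : ℕ) : ℝ) + 1) •
        (s (θ + (((j + j₀ : ℕ) : ℝ) + 1)⁻¹ • v) p - s θ p)) (fun j => ?_) ?_
    · exact ((hs _ (hj₀ _ (by omega))).sub (hs θ hθ)).const_smul _
    · filter_upwards [hd] with p hp
      have h1 : Tendsto (fun j : ℕ => ((j + j₀ : ℕ) : ℝ) + 1) atTop atTop :=
        tendsto_atTop_add_const_right _ _
          (tendsto_natCast_atTop_atTop.comp (tendsto_add_atTop_nat j₀))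
      exact (hp.hasFDerivAt.lim_real v).comp h1
  set b := Module.finBasis ℝ V
  -- The derivative is a continuous function of its finitely many values on a basis.
  have heq : (fun p => fderiv ℝ (fun t => s t p) θ) = fun p => ∑ i,
      (ContinuousLinearMap.smulRightL ℝ V E (LinearMap.toContinuousLinearMap (b.coord i)))
        (fderiv ℝ (fun t => s t p) θ (b i)) := by
    funext p
    ext v
    conv_lhs => rw [← b.sum_repr v, map_sum]
    simp
  rw [heq]
  exact Finset.aestronglyMeasurable_fun_sum _ fun i _ =>
    (ContinuousLinearMap.continuous _).comp_aestronglyMeasurable (hdir (b i))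

/-- With probability tending to one, averages of a dominated random `C¹` function are close to
affine near a given point, with the expected derivative as linear part. -/
lemma exists_highProb_norm_average_sub_sub_le (hX : ∀ i, HasLaw (X i) Q μ)
    (hind : iIndepFun X μ) (hm : Tendsto m atTop atTop) {s : V → S → E} {B : Set V}
    (hB : IsOpen B) {θ : V} (hθ : θ ∈ B) (hs : ∀ t ∈ B, AEStronglyMeasurable (s t) Q)
    (hcont : ∀ᵐ p ∂Q, ContDiffOn ℝ 1 (fun t => s t p) B)
    (hdom : ∃ h : S → ℝ, Integrable h Q ∧ ∀ᵐ p ∂Q, ∀ t ∈ B, ‖fderiv ℝ (fun t => s t p) t‖ ≤ h p)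
    {ε : ℝ} (hε : 0 < ε) :
    ∃ r > 0, Metric.closedBall θ r ⊆ B ∧ HighProb μ (fun k ω =>
      ∀ a ∈ Metric.closedBall θ r, ∀ b ∈ Metric.closedBall θ r,
      ‖average (m k) (fun i => X i ω) (s a) - average (m k) (fun i => X i ω) (s b)
        - (∫ p, fderiv ℝ (fun t => s t p) θ ∂Q) (a - b)‖ ≤ ε * ‖a - b‖) := by
  obtain ⟨h, hh, hsh⟩ := hdom
  set D : S → V →L[ℝ] E := fun p => fderiv ℝ (fun t => s t p) θ with hD
  have hdiff : ∀ᵐ p ∂Q, ∀ t ∈ B, DifferentiableAt ℝ (fun t => s t p) t := by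
    filter_upwards [hcont] with p hp t ht
    exact (hp.differentiableOn one_ne_zero).differentiableAt (hB.mem_nhds ht)
  have hDm : AEStronglyMeasurable D Q :=
    aestronglyMeasurable_fderiv hB hθ hs (hdiff.mono fun p hp => hp θ hθ)
  have hDi : Integrable D Q := Integrable.mono' hh hDm (hsh.mono fun p hp => hp θ hθ)
  obtain ⟨r₀, hr₀, hr₀B⟩ := Metric.nhds_basis_closedBall.mem_iff.1 (hB.mem_nhds hθ)
  set K : ℕ → Set V := fun j => Metric.closedBall θ (r₀ / ((j : ℝ) + 1)) with hK
  have hKB : ∀ j, K j ⊆ B := fun j =>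
    (Metric.closedBall_subset_closedBall (div_le_self hr₀.le (by simp))).trans hr₀B
  -- Indexing by pairs of distinct points and dividing the remainder by their distance turns the
  -- Lipschitz bound into a uniform bound; off the diagonal the quotient is continuous.
  set A : ℕ → Set (V × V) := fun j => (K j ×ˢ K j) ∩ {x | x.1 ≠ x.2} with hA
  have hsep : ∀ j, ∃ c ⊆ A j, c.Countable ∧ A j ⊆ closure c := fun j =>
    (TopologicalSpace.IsSeparable.of_separableSpace (A j)).exists_countable_dense_subset
  choose C hCA hC hAC using hsep
  -- The mean value inequality on the convex ball bounds the quotient by the oscillation of the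
  -- derivative about its value at `θ`.
  have hmv : ∀ p, (∀ t ∈ B, DifferentiableAt ℝ (fun t => s t p) t) → ∀ j c,
      (∀ t ∈ K j, ‖fderiv ℝ (fun t => s t p) t - D p‖ ≤ c) → ∀ x ∈ A j,
      ‖‖x.1 - x.2‖⁻¹ • (s x.1 p - s x.2 p - D p (x.1 - x.2))‖ ≤ c := by
    intro p hp j c hc x hx
    have hpos : 0 < ‖x.1 - x.2‖ := norm_pos_iff.2 (sub_ne_zero.2 hx.2)
    have := (convex_closedBall θ (r₀ / ((j : ℝ) + 1))).norm_image_sub_le_of_norm_hasFDerivWithin_le'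
      (f := fun t => s t p) (f' := fun t => fderiv ℝ (fun t => s t p) t) (φ := D p) (C := c)
      (fun t ht => ((hp t (hKB j ht)).hasFDerivAt).hasFDerivWithinAt) hc hx.1.2 hx.1.1
    rw [norm_smul, norm_inv, norm_norm, inv_mul_le_iff₀ hpos, mul_comm]
    exact this
  obtain ⟨j, hj⟩ := highProb_norm_average_le
    (G := fun (x : V × V) p => ‖x.1 - x.2‖⁻¹ • (s x.1 p - s x.2 p - D p (x.1 - x.2)))
    (A := A) (C := C) (h := fun p => h p + h p) hX hind hm (hh.add hh) hC hCA
    (fun j x hx => (((hs _ (hKB j (hCA j hx).1.1)).sub (hs _ (hKB j (hCA j hx).1.2))).sub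
      (hDm.apply_continuousLinearMap _)).const_smul _)
    (by
      filter_upwards [hcont] with p hp j x hx b hb
      refine norm_le_of_forall_mem_dense
        (g := fun x : V × V => ‖x.1 - x.2‖⁻¹ • (s x.1 p - s x.2 p - D p (x.1 - x.2)))
        ?_ (hCA j) (hAC j) hb hx
      have h1 : ContinuousOn (fun x : V × V => s x.1 p) (A j) :=
        hp.continuousOn.comp continuousOn_fst fun x hx => hKB j hx.1.1
      have h2 : ContinuousOn (fun x : V × V => s x.2 p) (A j) :=
        hp.continuousOn.comp continuousOn_snd fun x hx => hKB j hx.1.2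
      refine ContinuousOn.smul (ContinuousOn.inv₀ (by fun_prop) fun x hx => ?_)
        ((h1.sub h2).sub (by fun_prop))
      exact norm_ne_zero_iff.2 (sub_ne_zero.2 hx.2))
    (by
      filter_upwards [hsh, hdiff] with p hp hd j x hx
      refine hmv p hd j _ (fun t ht => ?_) x hx
      exact (norm_sub_le _ _).trans (add_le_add (hp t (hKB j ht)) (hp θ hθ)))
    (by
      filter_upwards [hcont, hdiff] with p hp hd ε hε
      have hc : ContinuousAt (fderiv ℝ (fun t => s t p)) θ :=
        (hp.continuousOn_fderiv_of_isOpen hB le_rfl).continuousAt (hB.mem_nhds hθ)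
      obtain ⟨δ, hδ, hdl⟩ := Metric.continuousAt_iff.1 hc ε hε
      have hz : Tendsto (fun j : ℕ => r₀ / ((j : ℝ) + 1)) atTop (𝓝 0) :=
        tendsto_const_nhds.div_atTop
          (tendsto_atTop_add_const_right _ _ tendsto_natCast_atTop_atTop)
      filter_upwards [hz.eventually (gt_mem_nhds hδ)] with j hj
      refine hmv p hd j ε fun t ht => ?_
      rw [← dist_eq_norm]
      exact (hdl (lt_of_le_of_lt ht hj)).le)
    (half_pos hε)
  refine ⟨r₀ / ((j : ℝ) + 1), by positivity, hKB j, ?_⟩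
  -- The other half of `ε` pays for replacing the averaged derivative at `θ` by its expectation,
  -- through the law of large numbers in the space of operators with its Borel σ-algebra.
  have hL := tendstoInMeasure_iff_highProb.1
    (letI : MeasurableSpace (V →L[ℝ] E) := borel _
     haveI : BorelSpace (V →L[ℝ] E) := ⟨rfl⟩
     tendstoInMeasure_average hX hind hm hDi)
    (ε / 2) (half_pos hε)
  refine (hj.and hL).mono fun k ω ⟨h1, h2⟩ a ha b hb => ?_
  rcases eq_or_ne a b with rfl | hab
  · simp
  have hpos : 0 < ‖a - b‖ := norm_pos_iff.2 (sub_ne_zero.2 hab)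
  have h3 := h1 (a, b) ⟨⟨ha, hb⟩, hab⟩
  rw [dist_eq_norm] at h2
  have h5 : average (m k) (fun i => X i ω)
      (fun p => ‖a - b‖⁻¹ • (s a p - s b p - D p (a - b))) = ‖a - b‖⁻¹ •
      (average (m k) (fun i => X i ω) (s a) - average (m k) (fun i => X i ω) (s b)
        - average (m k) (fun i => X i ω) D (a - b)) := by
    simp only [average, ← Finset.smul_sum, Finset.sum_sub_distrib,
      _root_.smul_apply, _root_.sum_apply]
    rw [smul_comm]
    simp only [smul_sub]
  simp only [] at h3
  rw [h5, norm_smul, norm_inv, norm_norm, inv_mul_le_iff₀ hpos] at h3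
  have h4 : average (m k) (fun i => X i ω) (s a) - average (m k) (fun i => X i ω) (s b)
      - (∫ p, D p ∂Q) (a - b) = (average (m k) (fun i => X i ω) (s a)
        - average (m k) (fun i => X i ω) (s b) - average (m k) (fun i => X i ω) D (a - b))
      + (average (m k) (fun i => X i ω) D - ∫ p, D p ∂Q) (a - b) := by
    rw [_root_.sub_apply]
    abel
  rw [h4]
  refine (norm_add_le _ _).trans ?_
  have h6 := (average (m k) (fun i => X i ω) D - ∫ p, D p ∂Q).le_of_opNorm_le h2.le (a - b)
  linarith

end Regularity

/-! ### Boundedness in probability -/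

section Distribution

variable {Ω Ω' E F : Type*} [MeasurableSpace Ω] [MeasurableSpace Ω'] {μ : Measure Ω}
  [IsProbabilityMeasure μ] {ν : Measure Ω'} [IsProbabilityMeasure ν]
  [NormedAddCommGroup E] [MeasurableSpace E] [BorelSpace E]

/-- A sequence that converges in distribution is bounded in probability. -/
lemma exists_eventually_measure_norm_lt {X : ℕ → Ω → E} {Z : Ω' → E}
    (h : TendstoInDistribution X atTop Z (fun _ => μ) ν) {ε : ℝ≥0∞} (hε : 0 < ε) :
    ∃ M : ℝ, 0 < M ∧ ∀ᶠ k in atTop, μ {ω | M ≤ ‖X k ω‖} < ε := by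
  have hcl : ∀ M : ℝ, IsClosed {x : E | M ≤ ‖x‖} := fun M =>
    isClosed_le continuous_const continuous_norm
  have hZ := h.aemeasurable_limit
  have htail : Tendsto (fun j : ℕ => ν.map Z {x | (j : ℝ) + 1 ≤ ‖x‖}) atTop (𝓝 0) := by
    have := Measure.isProbabilityMeasure_map (μ := ν) hZ
    have h1 := tendsto_measure_iInter_atTop (μ := ν.map Z)
      (s := fun j : ℕ => {x : E | (j : ℝ) + 1 ≤ ‖x‖})
      (fun j => (hcl _).measurableSet.nullMeasurableSet)
      (fun i j hij x (hx : (j : ℝ) + 1 ≤ ‖x‖) => le_trans (by simpa using hij) hx) ⟨0, measure_ne_top _ _⟩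
    have h2 : (⋂ j : ℕ, {x : E | (j : ℝ) + 1 ≤ ‖x‖}) = ∅ := by
      ext x
      simp only [Set.mem_iInter, Set.mem_ofPred_eq, Set.mem_empty_iff_false, iff_false, not_forall,
        not_le]
      obtain ⟨j, hj⟩ := exists_nat_gt ‖x‖
      exact ⟨j, by linarith⟩
    rwa [h2, measure_empty] at h1
  obtain ⟨j, hj⟩ := (htail.eventually (gt_mem_nhds hε)).exists
  refine ⟨(j : ℝ) + 1, by positivity, ?_⟩
  -- The portmanteau inequality is available because the tail sets are closed.
  have hlim := ProbabilityMeasure.limsup_measure_closed_le_of_tendsto h.tendsto (hcl ((j : ℝ) + 1))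
  have := eventually_lt_of_limsup_lt (hlim.trans_lt hj)
  filter_upwards [this] with k hk
  rwa [ProbabilityMeasure.coe_mk,
    Measure.map_apply_of_aemeasurable (h.forall_aemeasurable k) (hcl _).measurableSet] at hk

/-- A sequence that is negligible relative to one converging in distribution vanishes in
probability. -/
lemma tendstoInMeasure_zero_of_norm_le_mul [NormedAddCommGroup F] {X : ℕ → Ω → E} {Z : Ω' → E}
    (h : TendstoInDistribution X atTop Z (fun _ => μ) ν) {R : ℕ → Ω → F}
    (hR : ∀ η : ℝ, 0 < η → HighProb μ (fun k ω => ‖R k ω‖ ≤ η * (‖X k ω‖ + 1))) :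
    TendstoInMeasure μ R atTop 0 := by
  rw [tendstoInMeasure_iff_norm]
  intro δ hδ
  refine ENNReal.tendsto_nhds_zero.2 fun ε hε => ?_
  obtain ⟨M, hM, hk⟩ := exists_eventually_measure_norm_lt h (ENNReal.half_pos hε.ne')
  -- With this constant the bound is at most `δ / 2 < δ` wherever `‖X k ω‖ < M`.
  have h2 := hR (δ / (2 * (M + 1))) (by positivity)
  filter_upwards [hk, h2.eventually (gt_mem_nhds (ENNReal.half_pos hε.ne'))] with k h3 h4
  refine le_trans ((measure_mono fun ω hω => ?_).trans (measure_union_le _ _))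
    ((add_le_add h3.le h4.le).trans (ENNReal.add_halves ε).le)
  simp only [Set.mem_ofPred_eq, Set.mem_union, Pi.zero_apply, sub_zero] at hω ⊢
  by_contra! hc
  have h5 : δ / (2 * (M + 1)) * (‖X k ω‖ + 1) ≤ δ / (2 * (M + 1)) * (M + 1) := by
    gcongr
    exact hc.1.le
  have h6 : δ / (2 * (M + 1)) * (M + 1) = δ / 2 := by field_simp
  linarith [hc.2]

end Distribution

/-! ### Central limit theorems -/

section CentralLimit

variable {Ω S S' : Type*} [MeasurableSpace Ω] [MeasurableSpace S] [MeasurableSpace S']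
  {μ : Measure Ω} [IsProbabilityMeasure μ] {Q : Measure S} [IsProbabilityMeasure Q]
  {Q' : Measure S'} [IsProbabilityMeasure Q'] {X : ℕ → Ω → S} {X' : ℕ → Ω → S'} {n N : ℕ → ℕ}

/-- The central limit theorem along a sequence of sample sizes. -/
lemma tendstoInDistribution_sqrt_mul_average_sub (hX : ∀ i, HasLaw (X i) Q μ)
    (hind : iIndepFun X μ) (hn : Tendsto n atTop atTop) {φ : S → ℝ} (hφ : Measurable φ)
    (hφ2 : MemLp φ 2 Q) :
    TendstoInDistribution
      (fun k ω => √(n k : ℝ) * (average (n k) (fun i => X i ω) φ - ∫ p, φ p ∂Q)) atTop id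
      (fun _ => μ) (gaussianReal 0 Var[φ; Q].toNNReal) := by
  have hlaw : ∀ i, HasLaw (φ ∘ X i) (Q.map φ) μ := fun i =>
    HasLaw.comp ⟨hφ.aemeasurable, rfl⟩ (hX i)
  have hvar : Var[φ ∘ X 0; μ] = Var[φ; Q] := by
    rw [← (hX 0).map_eq, variance_map (by fun_prop) (hX 0).aemeasurable]
  have hmean : ∫ ω, (φ ∘ X 0) ω ∂μ = ∫ p, φ p ∂Q :=
    (hX 0).integral_comp hφ.aestronglyMeasurable
  have key := tendstoInDistribution_inv_sqrt_mul_sum_sub (P := μ) (X := fun i => φ ∘ X i)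
    (P' := gaussianReal 0 Var[φ ∘ X 0; μ].toNNReal) (Y := id) HasLaw.id
    (((hX 0).map_eq.symm ▸ hφ2).comp_of_map (hX 0).aemeasurable)
    (hind.comp (fun _ => φ) fun _ => hφ)
    (fun i => ⟨(hlaw i).aemeasurable, (hlaw 0).aemeasurable, by
      rw [(hlaw i).map_eq, (hlaw 0).map_eq]⟩)
  rw [hvar, hmean] at key
  have heq : (fun k ω => √(n k : ℝ) * (average (n k) (fun i => X i ω) φ - ∫ p, φ p ∂Q))
      = fun k ω => (√(n k : ℝ))⁻¹ *
        (∑ i ∈ Finset.range (n k), (φ ∘ X i) ω - (n k : ℝ) * ∫ p, φ p ∂Q) := by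
    funext k ω
    rcases Nat.eq_zero_or_pos (n k) with h0 | h0
    · simp [h0]
    have h1 : (0 : ℝ) < n k := Nat.cast_pos.2 h0
    have h2 : 0 < √(n k : ℝ) := Real.sqrt_pos.2 h1
    have h3 : √(n k : ℝ) * √(n k : ℝ) = n k := Real.mul_self_sqrt h1.le
    simp only [average, smul_eq_mul, Function.comp]
    rw [eq_inv_mul_iff_mul_eq₀ h2.ne', ← mul_assoc, h3, mul_sub, mul_inv_cancel_left₀ h1.ne']
  rw [heq]
  exact ⟨fun k => key.forall_aemeasurable (n k), key.aemeasurable_limit, key.tendsto.comp hn⟩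

/-- The central limit theorem for the sum of two independent sample averages, normalized with the
first sample size. -/
lemma tendstoInDistribution_twoSample {ι : Type*} [Fintype ι] [DecidableEq ι]
    (hX : ∀ i, HasLaw (X i) Q μ) (hind : iIndepFun X μ)
    (hX' : ∀ i, HasLaw (X' i) Q' μ) (hind' : iIndepFun X' μ)
    (hindep : IndepFun (fun ω i => X i ω) (fun ω i => X' i ω) μ)
    (hn : Tendsto n atTop atTop) (hN : Tendsto N atTop atTop) {ρ : ℝ}
    (hρ : Tendsto (fun k => (n k : ℝ) / (N k : ℝ)) atTop (𝓝 ρ))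
    {g : S → EuclideanSpace ℝ ι} {h : S' → EuclideanSpace ℝ ι} (hg : Measurable g)
    (hh : Measurable h) (hg2 : MemLp g 2 Q) (hh2 : MemLp h 2 Q')
    {M : Matrix ι ι ℝ} (hM : M.PosSemidef)
    (hvar : ∀ t : EuclideanSpace ℝ ι, t.ofLp ⬝ᵥ M.mulVec t.ofLp =
      Var[fun p => inner ℝ (g p) t; Q] + ρ * Var[fun p => inner ℝ (h p) t; Q']) :
    TendstoInDistribution
      (fun k ω => √(n k : ℝ) • ((average (n k) (fun i => X i ω) g - ∫ p, g p ∂Q)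
        + (average (N k) (fun i => X' i ω) h - ∫ p, h p ∂Q'))) atTop id
      (fun _ => μ) (multivariateGaussian 0 M) := by
  have hXm : ∀ i, AEMeasurable (X i) μ := fun i => (hX i).aemeasurable
  have hXm' : ∀ i, AEMeasurable (X' i) μ := fun i => (hX' i).aemeasurable
  have hgX : ∀ i, AEMeasurable (fun ω => g (X i ω)) μ := fun i => hg.comp_aemeasurable (hXm i)
  have hhX : ∀ i, AEMeasurable (fun ω => h (X' i ω)) μ := fun i => hh.comp_aemeasurable (hXm' i)
  have hmeas : ∀ k, AEMeasurable (fun ω => √(n k : ℝ) •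
      ((average (n k) (fun i => X i ω) g - ∫ p, g p ∂Q)
        + (average (N k) (fun i => X' i ω) h - ∫ p, h p ∂Q'))) μ := by
    intro k
    unfold average
    fun_prop
  refine ⟨hmeas, by fun_prop, ?_⟩
  -- By Lévy's continuity theorem a fixed direction `t` suffices; the inner product with `t` is a
  -- sum of two independent real variables, whose characteristic functions multiply.
  refine ProbabilityMeasure.tendsto_iff_tendsto_charFun.2 fun t => ?_
  simp only [ProbabilityMeasure.coe_mk, Measure.map_id]
  have hφm : Measurable fun p => inner ℝ (g p) t := by fun_prop
  have hφm' : Measurable fun p => inner ℝ (h p) t := by fun_prop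
  have hφ2 : MemLp (fun p => inner ℝ (g p) t) 2 Q := hg2.inner_const t
  have hφ2' : MemLp (fun p => inner ℝ (h p) t) 2 Q' := hh2.inner_const t
  have T1 := tendstoInDistribution_sqrt_mul_average_sub hX hind hn hφm hφ2
  have T2 := tendstoInDistribution_sqrt_mul_average_sub hX' hind' hN hφm' hφ2'
  set φ := fun p => inner ℝ (g p) t with hφ
  set φ' := fun p => inner ℝ (h p) t with hφ'
  have hρ0 : 0 ≤ ρ := ge_of_tendsto' hρ fun k => by positivity
  -- The second average has its own rate √N; the factor √(n/N) → √ρ rescales it to √n and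
  -- contributes `ρ` to the variance.
  have hsq : TendstoInMeasure μ (fun k _ => √((n k : ℝ) / (N k : ℝ))) atTop (fun _ : Ω => √ρ) := by
    refine tendstoInMeasure_of_tendsto_ae (fun k => aestronglyMeasurable_const) ?_
    exact Eventually.of_forall fun ω => (Real.continuous_sqrt.tendsto ρ).comp hρ
  have T3 := T2.continuous_comp_prodMk_of_tendstoInMeasure_const
    (g := fun x : ℝ × ℝ => x.2 * x.1) (by fun_prop) hsq (fun k => aemeasurable_const)
  have C1 := ProbabilityMeasure.tendsto_iff_tendsto_charFun.1 T1.tendsto 1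
  have C3 := ProbabilityMeasure.tendsto_iff_tendsto_charFun.1 T3.tendsto 1
  have C := C1.mul C3
  simp only [ProbabilityMeasure.coe_mk, id] at C
  have hlim : charFun (multivariateGaussian 0 M) t =
      charFun (Measure.map (fun x => x) (gaussianReal 0 Var[φ; Q].toNNReal)) 1 *
      charFun (Measure.map (fun x => √ρ * x) (gaussianReal 0 Var[φ'; Q'].toNNReal)) 1 := by
    rw [charFun_multivariateGaussian hM, charFun_map_mul, Measure.map_id', charFun_gaussianReal,
      charFun_gaussianReal, ← Complex.exp_add, hvar t]
    congr 1
    have h1 : ((√ρ : ℝ) : ℂ) ^ 2 = (ρ : ℂ) := by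
      rw [← Complex.ofReal_pow, Real.sq_sqrt hρ0]
    have h2 : ((Var[φ; Q].toNNReal : ℝ) : ℂ) = (Var[φ; Q] : ℂ) := by
      rw [Real.coe_toNNReal _ (variance_nonneg _ _)]
    have h3 : ((Var[φ'; Q'].toNNReal : ℝ) : ℂ) = (Var[φ'; Q'] : ℂ) := by
      rw [Real.coe_toNNReal _ (variance_nonneg _ _)]
    simp only [inner_zero_right, Complex.ofReal_zero, zero_mul, mul_zero, zero_sub, h2, h3,
      Complex.ofReal_one, mul_one, one_pow, h1]
    push_cast
    ring
  rw [hlim]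
  refine C.congr' ?_
  -- √(n/N)·√N = √n requires N > 0, as division by zero gives 0.
  filter_upwards [hN.eventually_gt_atTop 0] with k hNk
  have hI : IndepFun (fun ω => √(n k : ℝ) * (average (n k) (fun i => X i ω) φ - ∫ p, φ p ∂Q))
      (fun ω => √((n k : ℝ) / (N k : ℝ)) *
        (√(N k : ℝ) * (average (N k) (fun i => X' i ω) φ' - ∫ p, φ' p ∂Q'))) μ := by
    refine hindep.comp (φ := fun x : ℕ → S => √(n k : ℝ) * (average (n k) x φ - ∫ p, φ p ∂Q))
      (ψ := fun x : ℕ → S' => √((n k : ℝ) / (N k : ℝ)) *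
        (√(N k : ℝ) * (average (N k) x φ' - ∫ p, φ' p ∂Q'))) ?_ ?_
    · unfold average
      fun_prop
    · unfold average
      fun_prop
  have hprod := congrFun (hI.charFun_map_fun_add_eq_mul (T1.forall_aemeasurable k)
    (T3.forall_aemeasurable k)) 1
  rw [Pi.mul_apply] at hprod
  rw [← hprod, charFun_apply_real, charFun_apply,
    integral_map (hmeas k) (by fun_prop),
    integral_map ((T1.forall_aemeasurable k).fun_add (T3.forall_aemeasurable k)) (by fun_prop)]
  congr 1
  funext ω
  have hg1 : Integrable g Q := hg2.integrable one_le_two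
  have hh1 : Integrable h Q' := hh2.integrable one_le_two
  have e1 : ∫ p, φ p ∂Q = inner ℝ (∫ p, g p ∂Q) t := by
    simp only [hφ, real_inner_comm t]
    exact integral_inner hg1 t
  have e2 : ∫ p, φ' p ∂Q' = inner ℝ (∫ p, h p ∂Q') t := by
    simp only [hφ', real_inner_comm t]
    exact integral_inner hh1 t
  have e3 : √((n k : ℝ) / (N k : ℝ)) * √(N k : ℝ) = √(n k : ℝ) := by
    rw [← Real.sqrt_mul (by positivity), div_mul_cancel₀ _ (Nat.cast_pos.2 hNk).ne']
  have e4 : inner ℝ (√(n k : ℝ) • ((average (n k) (fun i => X i ω) g - ∫ p, g p ∂Q)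
        + (average (N k) (fun i => X' i ω) h - ∫ p, h p ∂Q'))) t =
      √(n k : ℝ) * (average (n k) (fun i => X i ω) φ - ∫ p, φ p ∂Q)
      + √((n k : ℝ) / (N k : ℝ)) *
        (√(N k : ℝ) * (average (N k) (fun i => X' i ω) φ' - ∫ p, φ' p ∂Q')) := by
    rw [← mul_assoc, e3, e1, e2]
    simp only [average, real_inner_smul_left, inner_add_left, inner_sub_left, sum_inner, hφ, hφ',
      smul_eq_mul]
    ring
  rw [e4]
  simp

end CentralLimit

/-! ### Diagonal weights and zeros of nearly affine maps -/

section Weights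

variable {q : ℕ}

lemma norm_diagMul_le (w v : Vec q) : ‖diagMul w v‖ ≤ ‖w‖ * ‖v‖ := by
  refine (sq_le_sq₀ (norm_nonneg _) (by positivity)).1 ?_
  rw [mul_pow, EuclideanSpace.real_norm_sq_eq (diagMul w v), EuclideanSpace.real_norm_sq_eq v,
    Finset.mul_sum]
  refine Finset.sum_le_sum fun j _ => ?_
  simp only [diagMul, mul_pow]
  refine mul_le_mul_of_nonneg_right ?_ (sq_nonneg _)
  exact sq_le_sq' (neg_le_of_abs_le (PiLp.norm_apply_le w j)) (le_of_abs_le (PiLp.norm_apply_le w j))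

/-- Multiplication by `diag(w)` as a continuous linear map. -/
noncomputable def diagCLM (w : Vec q) : Vec q →L[ℝ] Vec q :=
  LinearMap.toContinuousLinearMap
    { toFun := diagMul w
      map_add' := fun u v => by ext; simp [diagMul, mul_add]
      map_smul' := fun c v => by ext; simp [diagMul, mul_left_comm] }

lemma diagCLM_apply (w v : Vec q) : diagCLM w v = diagMul w v := rfl

lemma diagMul_sub_left (w w' v : Vec q) : diagMul (w - w') v = diagMul w v - diagMul w' v := by
  ext; simp [diagMul, sub_mul]

lemma diagMul_sub_right (w v v' : Vec q) : diagMul w (v - v') = diagMul w v - diagMul w v' :=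
  map_sub (diagCLM w) v v'

lemma inner_diagMul_left (w v u : Vec q) : inner ℝ (diagMul w v) u = inner ℝ v (diagMul w u) := by
  simp only [diagMul, PiLp.inner_apply]
  refine Finset.sum_congr rfl fun j _ => ?_
  simp only [RCLike.inner_apply, conj_trivial]
  ring

/-- A map close to an invertible linear map on a ball, with a small value at the center, has a
zero in the ball. -/
lemma exists_mem_closedBall_eq_zero {V : Type*} [NormedAddCommGroup V] [NormedSpace ℝ V]
    [CompleteSpace V] {F : V → V} {D D' : V →L[ℝ] V} (hD : ∀ v, D (D' v) = v) {c r : ℝ} {x : V}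
    (hc0 : 0 ≤ c) (hr : 0 ≤ r) (hc : c * (2 * (‖D'‖ + 1)) ≤ 1)
    (happ : ∀ a ∈ Metric.closedBall x r, ∀ b ∈ Metric.closedBall x r,
      ‖F a - F b - D (a - b)‖ ≤ c * ‖a - b‖)
    (hx : ‖F x‖ * (2 * (‖D'‖ + 1)) ≤ r) : ∃ y ∈ Metric.closedBall x r, F y = 0 := by
  -- The constant `‖D'‖ + 1` is positive even when `D' = 0`.
  let R : D.NonlinearRightInverse := ⟨D', ‖D'‖₊ + 1, fun y => by
    refine (D'.le_opNorm y).trans ?_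
    push_cast
    gcongr
    simp, hD⟩
  have hA : ApproximatesLinearOn F D (Metric.closedBall x r) c.toNNReal := by
    intro a ha b hb
    rw [Real.coe_toNNReal c hc0]
    exact happ a ha b hb
  have hpos : 0 < ‖D'‖ + 1 := by positivity
  -- The image of the ball contains the ball about `F x` of radius `((‖D'‖ + 1)⁻¹ - c) * r`. As `c`
  -- is at most half of `(‖D'‖ + 1)⁻¹`, this radius is at least `‖F x‖`, so 0 is attained.
  have hsurj := hA.surjOn_closedBall_of_nonlinearRightInverse R hr subset_rfl
  refine hsurj ?_
  rw [Metric.mem_closedBall, dist_zero_left]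
  have hR : (R.nnnorm : ℝ) = ‖D'‖ + 1 := by simp [R]
  rw [hR, Real.coe_toNNReal c hc0]
  have h1 : c ≤ (2 * (‖D'‖ + 1))⁻¹ := by
    rwa [← one_div, le_div_iff₀ (by positivity)]
  have h2 : ‖F x‖ ≤ (2 * (‖D'‖ + 1))⁻¹ * r := by
    rwa [← div_eq_inv_mul, le_div_iff₀ (by positivity)]
  refine h2.trans ?_
  gcongr
  have h3 : (‖D'‖ + 1)⁻¹ = 2 * (2 * (‖D'‖ + 1))⁻¹ := by field_simp
  linarith

end Weights

/-! ### Covariance matrices as bilinear forms -/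

section Covariance

variable {q : ℕ} {S : Type*} [MeasurableSpace S] {Q : Measure S}

lemma covMatrix_transpose (U V : S → Vec q) : (covMatrix Q U V).transpose = covMatrix Q V U := by
  ext i j
  exact covariance_comm _ _

lemma dotProduct_covMatrix_mulVec [IsFiniteMeasure Q] {U V : S → Vec q} (hU : MemLp U 2 Q)
    (hV : MemLp V 2 Q) (u v : Vec q) :
    u.ofLp ⬝ᵥ (covMatrix Q U V).mulVec v.ofLp =
      cov[fun p => inner ℝ (U p) u, fun p => inner ℝ (V p) v; Q] := by
  have hco : ∀ {W : S → Vec q}, MemLp W 2 Q → ∀ (t : Vec q) i,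
      MemLp (fun p => t i * W p i) 2 Q := fun hW t i =>
    ((EuclideanSpace.proj (𝕜 := ℝ) i).comp_memLp' hW).const_mul _
  simp only [PiLp.inner_apply, RCLike.inner_apply, conj_trivial]
  rw [covariance_fun_sum_fun_sum (hco hU u) (hco hV v)]
  simp only [dotProduct, Matrix.mulVec, covMatrix, Matrix.of_apply, Finset.mul_sum,
    covariance_const_mul_left, covariance_const_mul_right]
  refine Finset.sum_congr rfl fun i _ => Finset.sum_congr rfl fun j _ => ?_
  ring

end Covariance

/-! ### The asymptotic covariance matrix -/

section AsymptoticVariance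

variable {d q : ℕ} {Z : Type*} [MeasurableSpace Z] {P : Measure (ℝ × Vec d × Z)}
  [IsProbabilityMeasure P] {ψ : ℝ → Vec d → Vec q → Vec q} {f : Z → ℝ} {ρ : ℝ} {w θ : Vec q}

/-- Moving diag(w) onto the test vector reduces this to the expansion of the variance of a
difference: M₄ diag(w) and its transpose contribute equally, giving the factor 2 of the cross term.
-/
lemma dotProduct_matV_mulVec (hY : MemLp (scoreY ψ θ) 2 P)
    (hF : MemLp (scoreF ψ f θ) 2 (P.map Prod.snd)) (u : Vec q) :
    u.ofLp ⬝ᵥ (matV P ψ f ρ w θ).mulVec u.ofLp =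
      Var[fun p => inner ℝ (scoreY ψ θ p - diagMul w (scoreF ψ f θ p.2)) u; P]
        + ρ * Var[fun v => inner ℝ (diagMul w (scoreF ψ f θ v)) u; P.map Prod.snd] := by
  have : IsProbabilityMeasure (P.map Prod.snd) :=
    Measure.isProbabilityMeasure_map measurable_snd.aemeasurable
  have hF' : MemLp (fun p : ℝ × Vec d × Z => scoreF ψ f θ p.2) 2 P :=
    hF.comp_of_map measurable_snd.aemeasurable
  have hdiag : (Matrix.diagonal w.ofLp).mulVec u.ofLp = (diagMul w u).ofLp := by
    ext i
    simp [diagMul, Matrix.mulVec_diagonal]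
  have hdiag' : ∀ y : Fin q → ℝ, u.ofLp ⬝ᵥ (Matrix.diagonal w.ofLp).mulVec y
      = (diagMul w u).ofLp ⬝ᵥ y := by
    intro y
    simp only [dotProduct, Matrix.mulVec_diagonal, diagMul]
    exact Finset.sum_congr rfl fun i _ => by ring
  have ha := hY.inner_const (𝕜 := ℝ) u
  have hb := hF'.inner_const (𝕜 := ℝ) (diagMul w u)
  have hb' := hF.inner_const (𝕜 := ℝ) (diagMul w u)
  simp only [inner_sub_left, inner_diagMul_left]
  rw [variance_fun_sub ha hb, ← covariance_self hb'.aestronglyMeasurable.aemeasurable,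
    ← covariance_self ha.aestronglyMeasurable.aemeasurable,
    ← covariance_self hb.aestronglyMeasurable.aemeasurable]
  rw [← dotProduct_covMatrix_mulVec hY hY, ← dotProduct_covMatrix_mulVec hF' hF',
    ← dotProduct_covMatrix_mulVec hF hF, ← dotProduct_covMatrix_mulVec hY hF']
  have hM4 : (matM4 P ψ f θ).transpose
      = covMatrix P (fun p => scoreF ψ f θ p.2) (scoreY ψ θ) := covMatrix_transpose _ _
  have hsymm : (diagMul w u).ofLp ⬝ᵥ
      (covMatrix P (fun p => scoreF ψ f θ p.2) (scoreY ψ θ)).mulVec u.ofLp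
      = u.ofLp ⬝ᵥ (covMatrix P (scoreY ψ θ) (fun p => scoreF ψ f θ p.2)).mulVec
        (diagMul w u).ofLp := by
    rw [dotProduct_covMatrix_mulVec hF' hY, dotProduct_covMatrix_mulVec hY hF', covariance_comm]
  simp only [matV, hM4, Matrix.add_mulVec, Matrix.sub_mulVec, ← Matrix.mulVec_mulVec,
    dotProduct_add, dotProduct_sub, hdiag, hdiag', Matrix.smul_mulVec, dotProduct_smul, hsymm]
  simp only [matM1, matM2, matM3, matM4, smul_eq_mul]
  ring

/-- The previous identity at the vector A⁻ᵀt, with the sign dropping out of the variances. This is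
the form required by `hvar` in `tendstoInDistribution_twoSample`. -/
lemma dotProduct_matSigma_mulVec (hY : MemLp (scoreY ψ θ) 2 P)
    (hF : MemLp (scoreF ψ f θ) 2 (P.map Prod.snd)) (t : Vec q) :
    t.ofLp ⬝ᵥ (matSigma P ψ f ρ w θ).mulVec t.ofLp =
      Var[fun p => inner ℝ (-Matrix.toEuclideanCLM (𝕜 := ℝ) (matA P ψ θ)⁻¹
          (scoreY ψ θ p - diagMul w (scoreF ψ f θ p.2))) t; P]
        + ρ * Var[fun v => inner ℝ (-Matrix.toEuclideanCLM (𝕜 := ℝ) (matA P ψ θ)⁻¹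
          (diagMul w (scoreF ψ f θ v))) t; P.map Prod.snd] := by
  set B := (matA P ψ θ)⁻¹ with hB
  have hadj : ∀ x : Vec q, inner ℝ (-Matrix.toEuclideanCLM (𝕜 := ℝ) B x) t
      = -inner ℝ x (WithLp.toLp 2 (B.transpose.mulVec t.ofLp)) := by
    intro x
    rw [inner_neg_left, real_inner_comm, Matrix.inner_toEuclideanCLM, real_inner_comm,
      EuclideanSpace.inner_eq_star_dotProduct, Matrix.dotProduct_mulVec, Matrix.mulVec_transpose]
    simp [dotProduct_comm]
  simp only [hadj]
  rw [variance_fun_neg, variance_fun_neg, ← dotProduct_matV_mulVec hY hF]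
  simp only [matSigma, ← hB, ← Matrix.mulVec_mulVec]
  rw [Matrix.dotProduct_mulVec, Matrix.mulVec_transpose]

lemma posSemidef_matSigma (hρ : 0 ≤ ρ) (hY : MemLp (scoreY ψ θ) 2 P)
    (hF : MemLp (scoreF ψ f θ) 2 (P.map Prod.snd)) : (matSigma P ψ f ρ w θ).PosSemidef := by
  refine .of_dotProduct_mulVec_nonneg ?_ fun x => ?_
  · have hV : (matV P ψ f ρ w θ).transpose = matV P ψ f ρ w θ := by
      simp only [matV, matM1, matM2, matM3, matM4, Matrix.transpose_add, Matrix.transpose_sub,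
        Matrix.transpose_mul, Matrix.transpose_smul, covMatrix_transpose,
        Matrix.diagonal_transpose, Matrix.mul_assoc]
      rw [add_comm (_ * covMatrix P _ (scoreY ψ θ))]
    rw [Matrix.IsHermitian, Matrix.conjTranspose_eq_transpose_of_trivial]
    simp only [matSigma, Matrix.transpose_mul, Matrix.transpose_transpose, hV, Matrix.mul_assoc]
  · have h := dotProduct_matSigma_mulVec (ρ := ρ) (w := w) hY hF (WithLp.toLp 2 x)
    rw [star_trivial, h]
    exact add_nonneg (variance_nonneg _ _) (mul_nonneg hρ (variance_nonneg _ _))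

end AsymptoticVariance

/-! ### Consistency under domination; local linearization -/

section Estimation

variable {d q : ℕ} {Z Ω : Type*} [MeasurableSpace Z] [MeasurableSpace Ω] {μ : Measure Ω}
  [IsProbabilityMeasure μ] {P : Measure (ℝ × Vec d × Z)} [IsProbabilityMeasure P]
  {ψ : ℝ → Vec d → Vec q → Vec q} {f : Z → ℝ} {Θ : Set (Vec q)} {θ₀ : Vec q}
  {L : ℕ → Ω → ℝ × Vec d × Z} {U : ℕ → Ω → Vec d × Z} {n N : ℕ → ℕ}
  {w : Vec q} {what θhat : ℕ → Ω → Vec q}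

lemma estFun_eq (n N : ℕ) (l : ℕ → ℝ × Vec d × Z) (u : ℕ → Vec d × Z) (w θ : Vec q) :
    estFun ψ f n N l u w θ = average n l (scoreY ψ θ)
      + diagMul w (-average n (fun i => (l i).2) (scoreF ψ f θ) + average N u (scoreF ψ f θ)) :=
  rfl

lemma measurable_scoreY {θ : Vec q} (hψ : Measurable (fun p : ℝ × Vec d => ψ p.1 p.2 θ)) :
    Measurable (scoreY (Z := Z) ψ θ) :=
  hψ.comp (measurable_fst.prodMk (measurable_fst.comp measurable_snd))

lemma measurable_scoreF {θ : Vec q} (hψ : Measurable (fun p : ℝ × Vec d => ψ p.1 p.2 θ))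
    (hf : Measurable f) : Measurable (scoreF ψ f θ) :=
  hψ.comp ((hf.comp measurable_snd).prodMk measurable_fst)

instance isProbabilityMeasure_map_snd : IsProbabilityMeasure (P.map Prod.snd) :=
  Measure.isProbabilityMeasure_map measurable_snd.aemeasurable

lemma IIDSamples.law_labeled_snd (h : IIDSamples μ P L U) (i : ℕ) :
    HasLaw (fun ω => (L i ω).2) (P.map Prod.snd) μ :=
  HasLaw.fun_comp ⟨measurable_snd.aemeasurable, rfl⟩ (h.law_labeled i)

lemma IIDSamples.indep_labeled_snd (h : IIDSamples μ P L U) :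
    iIndepFun (fun i ω => (L i ω).2) μ :=
  h.indep_labeled.comp (fun _ => Prod.snd) fun _ => measurable_snd

lemma memLp_scoreY (hC3 : SecondMoments P ψ f Θ w) {θ : Vec q} (hθ : θ ∈ Θ)
    (hψ : Measurable (fun p : ℝ × Vec d => ψ p.1 p.2 θ)) : MemLp (scoreY ψ θ) 2 P := by
  refine ⟨(measurable_scoreY hψ).aestronglyMeasurable, ?_⟩
  rw [eLpNorm_lt_top_iff_lintegral_rpow_enorm_lt_top two_ne_zero ENNReal.ofNat_ne_top]
  have h := lt_of_le_of_lt
    (le_iSup₂ (f := fun θ (_ : θ ∈ Θ) => ∫⁻ p, ‖scoreY ψ θ p‖ₑ ^ 2 ∂P) θ hθ) hC3.outcome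
  simpa using h

lemma highProb_norm_weights_lt (hw : TendstoInMeasure μ what atTop (fun _ => w)) :
    HighProb μ (fun k ω => ‖what k ω‖ < ‖w‖ + 1) := by
  refine (tendstoInMeasure_iff_highProb.1 hw 1 one_pos).mono fun k ω h => ?_
  rw [dist_eq_norm] at h
  have := norm_le_norm_add_norm_sub' (what k ω) w
  linarith

/-- With probability tending to one, the estimating function has no zero near a parameter other
than the true one. -/
lemma exists_highProb_estFun_ne_zero (hψ : ∀ θ ∈ Θ, Measurable (fun p : ℝ × Vec d => ψ p.1 p.2 θ))
    (hf : Measurable f) (hn : Tendsto n atTop atTop) (hN : Tendsto N atTop atTop)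
    (hw : TendstoInMeasure μ what atTop (fun _ => w)) (hC1 : TrueParameter P ψ Θ θ₀)
    (hC4 : IIDSamples μ P L U) (hD : Dominated P ψ f Θ) {θ : Vec q} (hθ : θ ∈ Θ) (hne : θ ≠ θ₀) :
    ∃ r > 0, HighProb μ (fun k ω => ∀ t ∈ Θ ∩ Metric.ball θ r,
      estFun ψ f (n k) (N k) (fun i => L i ω) (fun j => U j ω) (what k ω) t ≠ 0) := by
  set m := ∫ p, scoreY ψ θ p ∂P with hm
  have hm0 : 0 < ‖m‖ := norm_pos_iff.2 fun h => hne ((hC1.unique θ hθ).1 h)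
  set κ := ‖w‖ + 1 with hκ
  have hκ0 : 0 < κ := by positivity
  -- Chosen so that the total error `ε + κ * (2 * ε)` equals `‖m‖ / 2`.
  set ε := ‖m‖ / (2 * (1 + 2 * κ)) with hε
  have hε0 : 0 < ε := by positivity
  have hmF : ∀ t ∈ Θ, AEStronglyMeasurable (scoreF ψ f t) (P.map Prod.snd) := fun t ht =>
    (measurable_scoreF (hψ t ht) hf).aestronglyMeasurable
  obtain ⟨r₁, hr₁, H₁⟩ := exists_highProb_norm_average_sub_integral_le hC4.law_labeled
    hC4.indep_labeled hn (s := scoreY ψ)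
    (fun t ht => (measurable_scoreY (hψ t ht)).aestronglyMeasurable)
    hD.continuous_outcome hD.envelope_outcome hθ hε0
  obtain ⟨r₂, hr₂, H₂⟩ := exists_highProb_norm_average_sub_integral_le hC4.law_labeled_snd
    hC4.indep_labeled_snd hn hmF hD.continuous_predicted hD.envelope_predicted hθ hε0
  obtain ⟨r₃, hr₃, H₃⟩ := exists_highProb_norm_average_sub_integral_le hC4.law_unlabeled
    hC4.indep_unlabeled hN hmF hD.continuous_predicted hD.envelope_predicted hθ hε0
  refine ⟨min r₁ (min r₂ r₃), by positivity, ?_⟩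
  refine (((H₁.and H₂).and H₃).and (highProb_norm_weights_lt hw)).mono ?_
  rintro k ω ⟨⟨⟨h₁, h₂⟩, h₃⟩, hwk⟩ t ⟨htΘ, ht⟩ h0
  have e₁ := h₁ t ⟨htΘ, Metric.ball_subset_ball (min_le_left _ _) ht⟩
  have e₂ := h₂ t ⟨htΘ, Metric.ball_subset_ball
    ((min_le_right _ _).trans (min_le_left _ _)) ht⟩
  have e₃ := h₃ t ⟨htΘ, Metric.ball_subset_ball
    ((min_le_right _ _).trans (min_le_right _ _)) ht⟩
  rw [estFun_eq] at h0
  set a := average (n k) (fun i => L i ω) (scoreY ψ t)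
  set b := average (n k) (fun i => (L i ω).2) (scoreF ψ f t)
  set c := average (N k) (fun j => U j ω) (scoreF ψ f t)
  set mF := ∫ v, scoreF ψ f θ v ∂(P.map Prod.snd)
  -- The labeled and unlabeled averages share the mean `mF`, which cancels.
  have hbc : ‖-b + c‖ ≤ 2 * ε := by
    have : -b + c = (c - mF) - (b - mF) := by abel
    rw [this]
    exact (norm_sub_le _ _).trans (by linarith)
  have hdm : ‖diagMul (what k ω) (-b + c)‖ ≤ κ * (2 * ε) := by
    refine (norm_diagMul_le _ _).trans ?_
    gcongr
  have hmeq : m = -(a - m) - diagMul (what k ω) (-b + c) := by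
    rw [eq_sub_iff_add_eq, ← sub_eq_zero]
    rw [← h0]
    abel
  have hle : ‖m‖ ≤ ε + κ * (2 * ε) := by
    calc ‖m‖ = ‖-(a - m) - diagMul (what k ω) (-b + c)‖ := by rw [← hmeq]
      _ ≤ ‖-(a - m)‖ + ‖diagMul (what k ω) (-b + c)‖ := norm_sub_le _ _
      _ ≤ ε + κ * (2 * ε) := by rw [norm_neg]; exact add_le_add e₁ hdm
  have : ε + κ * (2 * ε) = ‖m‖ / 2 := by
    rw [hε]
    field_simp
  linarith

/-- The estimator is a zero of the estimating function with probability tending to one. -/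
lemma highProb_estFun_eq_zero (hest : IsEstimator μ ψ f Θ n N L U what θhat)
    (hC2 : WellPosed μ ψ f Θ n N L U what) :
    HighProb μ (fun k ω => θhat k ω ∈ Θ ∧
      estFun ψ f (n k) (N k) (fun i => L i ω) (fun j => U j ω) (what k ω) (θhat k ω) = 0 ∧
      ∀ θ ∈ Θ, estFun ψ f (n k) (N k) (fun i => L i ω) (fun j => U j ω) (what k ω) θ = 0 →
        θ = θhat k ω) := by
  refine HighProb.mono_ae (E := fun k ω => _ ∧ _) hC2 (Eventually.of_forall fun k => ?_)
  filter_upwards [hest k] with ω hω h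
  obtain ⟨θ, ⟨hθ, h0⟩, huniq⟩ := h.2
  obtain ⟨h1, h2⟩ := hω ⟨θ, hθ, h0⟩
  refine ⟨h1, h2, fun θ' hθ' h0' => ?_⟩
  rw [huniq θ' ⟨hθ', h0'⟩, huniq _ ⟨h1, h2⟩]

/-- Consistency under a uniform domination condition. -/
theorem tendstoInMeasure_estimator_of_dominated
    (hψ : ∀ θ ∈ Θ, Measurable (fun p : ℝ × Vec d => ψ p.1 p.2 θ))
    (hf : Measurable f) (hn : Tendsto n atTop atTop) (hN : Tendsto N atTop atTop)
    (hw : TendstoInMeasure μ what atTop (fun _ => w))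
    (hest : IsEstimator μ ψ f Θ n N L U what θhat) (hC1 : TrueParameter P ψ Θ θ₀)
    (hC2 : WellPosed μ ψ f Θ n N L U what) (hC4 : IIDSamples μ P L U) (hD : Dominated P ψ f Θ) :
    TendstoInMeasure μ θhat atTop (fun _ => θ₀) := by
  rw [tendstoInMeasure_iff_highProb]
  intro δ hδ
  have hK : IsCompact (Θ \ Metric.ball θ₀ δ) := hC1.compact.diff Metric.isOpen_ball
  have key : HighProb μ (fun k ω => ∀ t ∈ Θ \ Metric.ball θ₀ δ,
      estFun ψ f (n k) (N k) (fun i => L i ω) (fun j => U j ω) (what k ω) t ≠ 0) := by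
    -- Absence of zeros with high probability passes to subsets and finite unions, so by compactness
    -- it need only be checked locally.
    refine hK.induction_on (p := fun s => HighProb μ (fun k ω => ∀ t ∈ s,
      estFun ψ f (n k) (N k) (fun i => L i ω) (fun j => U j ω) (what k ω) t ≠ 0)) ?_ ?_ ?_ ?_
    · exact highProb_of_ae fun k => Eventually.of_forall fun ω t ht => absurd ht (by simp)
    · exact fun s t hst ht => ht.mono fun k ω h x hx => h x (hst hx)
    · exact fun s t hs ht => (hs.and ht).mono fun k ω h x hx => hx.elim (h.1 x) (h.2 x)
    · intro θ hθ
      have hne : θ ≠ θ₀ := fun h => hθ.2 (h ▸ Metric.mem_ball_self hδ)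
      obtain ⟨r, hr, H⟩ := exists_highProb_estFun_ne_zero hψ hf hn hN hw hC1 hC4 hD hθ.1 hne
      refine ⟨Θ ∩ Metric.ball θ r, ?_, H⟩
      exact mem_nhdsWithin.2 ⟨Metric.ball θ r, Metric.isOpen_ball, Metric.mem_ball_self hr,
        fun x hx => ⟨hx.2.1, hx.1⟩⟩
  refine (key.and (highProb_estFun_eq_zero hest hC2)).mono fun k ω ⟨h1, h2⟩ => ?_
  by_contra hc
  exact h1 _ ⟨h2.1, hc⟩ h2.2.1

/-- With probability tending to one, the estimating function is close to affine near the true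
parameter. -/
lemma exists_highProb_estFun_sub_sub_le
    (hψ : ∀ θ ∈ Θ, Measurable (fun p : ℝ × Vec d => ψ p.1 p.2 θ))
    (hf : Measurable f) (hn : Tendsto n atTop atTop) (hN : Tendsto N atTop atTop)
    (hw : TendstoInMeasure μ what atTop (fun _ => w)) (hC4 : IIDSamples μ P L U)
    (hS : LocallySmooth P ψ f Θ θ₀) {c δ : ℝ} (hc : 0 < c) (hδ : 0 < δ) :
    ∃ r > 0, r ≤ δ ∧ Metric.closedBall θ₀ r ⊆ Θ ∧ HighProb μ (fun k ω =>
      ∀ a ∈ Metric.closedBall θ₀ r, ∀ b ∈ Metric.closedBall θ₀ r,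
      ‖estFun ψ f (n k) (N k) (fun i => L i ω) (fun j => U j ω) (what k ω) a
        - estFun ψ f (n k) (N k) (fun i => L i ω) (fun j => U j ω) (what k ω) b
        - Matrix.toEuclideanCLM (𝕜 := ℝ) (matA P ψ θ₀) (a - b)‖ ≤ c * ‖a - b‖) := by
  obtain ⟨B, hB, hθB, hBΘ, hYc, hFc, hYd, hFd⟩ := hS.exists_nhd
  set κ := ‖w‖ + 1 with hκ
  have hκ0 : 0 < κ := by positivity
  set ε := c / (1 + 2 * κ) with hε
  have hε0 : 0 < ε := by positivity
  have hmY : ∀ t ∈ B, AEStronglyMeasurable (scoreY ψ t) P := fun t ht =>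
    (measurable_scoreY (hψ t (hBΘ ht))).aestronglyMeasurable
  have hmF : ∀ t ∈ B, AEStronglyMeasurable (scoreF ψ f t) (P.map Prod.snd) := fun t ht =>
    (measurable_scoreF (hψ t (hBΘ ht)) hf).aestronglyMeasurable
  -- The entrywise integrals in `matA` agree with the integral of the operator, tested on basis
  -- vectors and coordinates.
  have hA : ∫ p, fderiv ℝ (fun t => scoreY ψ t p) θ₀ ∂P
      = Matrix.toEuclideanCLM (𝕜 := ℝ) (matA P ψ θ₀) := by
    obtain ⟨h, hh, hhd⟩ := hYd
    have hm : AEStronglyMeasurable (fun p => fderiv ℝ (fun t => scoreY ψ t p) θ₀) P :=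
      aestronglyMeasurable_fderiv hB hθB hmY (hYc.mono fun p hp =>
        (hp.differentiableOn one_ne_zero).differentiableAt (hB.mem_nhds hθB))
    have hi : Integrable (fun p => fderiv ℝ (fun t => scoreY ψ t p) θ₀) P :=
      Integrable.mono' hh hm (hhd.mono fun p hp => hp θ₀ hθB)
    refine ContinuousLinearMap.coe_injective ((EuclideanSpace.basisFun (Fin q) ℝ).toBasis.ext
      fun j => ?_)
    ext i
    simp only [OrthonormalBasis.coe_toBasis, EuclideanSpace.basisFun_apply,
      ContinuousLinearMap.coe_coe, Matrix.ofLp_toEuclideanCLM]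
    rw [ContinuousLinearMap.integral_apply hi]
    have := (EuclideanSpace.proj i : Vec q →L[ℝ] ℝ).integral_comp_comm
      (hi.apply_continuousLinearMap (EuclideanSpace.single j 1))
    simp only [PiLp.proj_apply] at this
    rw [← this]
    simp [matA]
  obtain ⟨r₁, hr₁, hb₁, H₁⟩ := exists_highProb_norm_average_sub_sub_le hC4.law_labeled
    hC4.indep_labeled hn hB hθB hmY hYc hYd hε0
  obtain ⟨r₂, hr₂, hb₂, H₂⟩ := exists_highProb_norm_average_sub_sub_le hC4.law_labeled_snd
    hC4.indep_labeled_snd hn hB hθB hmF hFc hFd hε0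
  obtain ⟨r₃, hr₃, hb₃, H₃⟩ := exists_highProb_norm_average_sub_sub_le hC4.law_unlabeled
    hC4.indep_unlabeled hN hB hθB hmF hFc hFd hε0
  rw [hA] at H₁
  set r := min δ (min r₁ (min r₂ r₃)) with hr
  have hrr₁ : r ≤ r₁ := (min_le_right _ _).trans (min_le_left _ _)
  have hrr₂ : r ≤ r₂ := (min_le_right _ _).trans ((min_le_right _ _).trans (min_le_left _ _))
  have hrr₃ : r ≤ r₃ := (min_le_right _ _).trans ((min_le_right _ _).trans (min_le_right _ _))
  refine ⟨r, by positivity, min_le_left _ _,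
    ((Metric.closedBall_subset_closedBall hrr₁).trans hb₁).trans hBΘ, ?_⟩
  refine (((H₁.and H₂).and H₃).and (highProb_norm_weights_lt hw)).mono ?_
  rintro k ω ⟨⟨⟨h₁, h₂⟩, h₃⟩, hwk⟩ a ha b hb
  have e₁ := h₁ a (Metric.closedBall_subset_closedBall hrr₁ ha) b
    (Metric.closedBall_subset_closedBall hrr₁ hb)
  have e₂ := h₂ a (Metric.closedBall_subset_closedBall hrr₂ ha) b
    (Metric.closedBall_subset_closedBall hrr₂ hb)
  have e₃ := h₃ a (Metric.closedBall_subset_closedBall hrr₃ ha) b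
    (Metric.closedBall_subset_closedBall hrr₃ hb)
  set DF := ∫ v, fderiv ℝ (fun t => scoreF ψ f t v) θ₀ ∂(P.map Prod.snd)
  set A := Matrix.toEuclideanCLM (𝕜 := ℝ) (matA P ψ θ₀)
  simp only [estFun_eq]
  set Ya := average (n k) (fun i => L i ω) (scoreY ψ a)
  set Yb := average (n k) (fun i => L i ω) (scoreY ψ b)
  set Fa := average (n k) (fun i => (L i ω).2) (scoreF ψ f a)
  set Fb := average (n k) (fun i => (L i ω).2) (scoreF ψ f b)
  set Ga := average (N k) (fun j => U j ω) (scoreF ψ f a)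
  set Gb := average (N k) (fun j => U j ω) (scoreF ψ f b)
  -- The expected derivative `DF` is the same for both predicted averages and cancels, leaving `A`
  -- as the only linear part.
  have hsplit : Ya + diagMul (what k ω) (-Fa + Ga) - (Yb + diagMul (what k ω) (-Fb + Gb))
      - A (a - b) = (Ya - Yb - A (a - b))
        + diagMul (what k ω) ((Ga - Gb - DF (a - b)) - (Fa - Fb - DF (a - b))) := by
    have : (Ga - Gb - DF (a - b)) - (Fa - Fb - DF (a - b)) = (-Fa + Ga) - (-Fb + Gb) := by abel
    rw [this, diagMul_sub_right]
    abel
  rw [hsplit]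
  have hdm : ‖diagMul (what k ω) ((Ga - Gb - DF (a - b)) - (Fa - Fb - DF (a - b)))‖
      ≤ κ * (ε * ‖a - b‖ + ε * ‖a - b‖) := by
    refine (norm_diagMul_le _ _).trans ?_
    gcongr
    exact (norm_sub_le _ _).trans (add_le_add e₃ e₂)
  refine (norm_add_le _ _).trans ((add_le_add e₁ hdm).trans (le_of_eq ?_))
  have : c = ε * (1 + 2 * κ) := by rw [hε]; field_simp
  rw [this]
  ring

end Estimation

/-! ### Expansion of the estimator and asymptotic normality -/

section Normality

variable {d q : ℕ} {Z Ω : Type*} [MeasurableSpace Z] [MeasurableSpace Ω] {μ : Measure Ω}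
  [IsProbabilityMeasure μ] {P : Measure (ℝ × Vec d × Z)} [IsProbabilityMeasure P]
  {ψ : ℝ → Vec d → Vec q → Vec q} {f : Z → ℝ} {Θ : Set (Vec q)} {θ₀ : Vec q}
  {L : ℕ → Ω → ℝ × Vec d × Z} {U : ℕ → Ω → Vec d × Z} {n N : ℕ → ℕ}
  {w : Vec q} {what θhat : ℕ → Ω → Vec q}

/-- The estimating function at the true parameter vanishes in probability. -/
lemma highProb_norm_estFun_le (hn : Tendsto n atTop atTop) (hN : Tendsto N atTop atTop)
    (hw : TendstoInMeasure μ what atTop (fun _ => w)) (hC1 : TrueParameter P ψ Θ θ₀)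
    (hC4 : IIDSamples μ P L U) (hY : Integrable (scoreY ψ θ₀) P)
    (hF : Integrable (scoreF ψ f θ₀) (P.map Prod.snd)) {c : ℝ} (hc : 0 < c) :
    HighProb μ (fun k ω =>
      ‖estFun ψ f (n k) (N k) (fun i => L i ω) (fun j => U j ω) (what k ω) θ₀‖ ≤ c) := by
  set κ := ‖w‖ + 1 with hκ
  have hκ0 : 0 < κ := by positivity
  set ε := c / (1 + 2 * κ) with hε
  have hε0 : 0 < ε := by positivity
  have H₁ := tendstoInMeasure_iff_highProb.1
    (tendstoInMeasure_average hC4.law_labeled hC4.indep_labeled hn hY) ε hε0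
  have H₂ := tendstoInMeasure_iff_highProb.1
    (tendstoInMeasure_average hC4.law_labeled_snd hC4.indep_labeled_snd hn hF) ε hε0
  have H₃ := tendstoInMeasure_iff_highProb.1
    (tendstoInMeasure_average hC4.law_unlabeled hC4.indep_unlabeled hN hF) ε hε0
  refine (((H₁.and H₂).and H₃).and (highProb_norm_weights_lt hw)).mono ?_
  rintro k ω ⟨⟨⟨h₁, h₂⟩, h₃⟩, hwk⟩
  rw [(hC1.unique θ₀ hC1.mem).2 rfl, dist_zero_right] at h₁
  rw [dist_eq_norm] at h₂ h₃
  rw [estFun_eq]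
  set b := average (n k) (fun i => (L i ω).2) (scoreF ψ f θ₀)
  set c' := average (N k) (fun j => U j ω) (scoreF ψ f θ₀)
  set mF := ∫ v, scoreF ψ f θ₀ v ∂(P.map Prod.snd)
  have hbc : -b + c' = (c' - mF) - (b - mF) := by abel
  have hdm : ‖diagMul (what k ω) (-b + c')‖ ≤ κ * (ε + ε) := by
    refine (norm_diagMul_le _ _).trans ?_
    gcongr
    rw [hbc]
    exact (norm_sub_le _ _).trans (add_le_add h₃.le h₂.le)
  refine (norm_add_le _ _).trans ((add_le_add h₁.le hdm).trans (le_of_eq ?_))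
  rw [hε]
  field_simp
  ring

lemma toEuclideanCLM_mul_inv_apply {A : Matrix (Fin q) (Fin q) ℝ} (hA : IsUnit A.det) (v : Vec q) :
    Matrix.toEuclideanCLM (𝕜 := ℝ) A (Matrix.toEuclideanCLM (𝕜 := ℝ) A⁻¹ v) = v := by
  rw [← mul_apply_eq_comp, ← map_mul, Matrix.mul_nonsing_inv A hA, map_one]
  rfl

lemma toEuclideanCLM_inv_mul_apply {A : Matrix (Fin q) (Fin q) ℝ} (hA : IsUnit A.det) (v : Vec q) :
    Matrix.toEuclideanCLM (𝕜 := ℝ) A⁻¹ (Matrix.toEuclideanCLM (𝕜 := ℝ) A v) = v := by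
  rw [← mul_apply_eq_comp, ← map_mul, Matrix.nonsing_inv_mul A hA, map_one]
  rfl

/-- With probability tending to one, the estimator is close to the true parameter and satisfies
the linearized estimating equation up to a small relative error. -/
lemma highProb_estimator_expansion
    (hψ : ∀ θ ∈ Θ, Measurable (fun p : ℝ × Vec d => ψ p.1 p.2 θ))
    (hf : Measurable f) (hn : Tendsto n atTop atTop) (hN : Tendsto N atTop atTop)
    (hw : TendstoInMeasure μ what atTop (fun _ => w))
    (hest : IsEstimator μ ψ f Θ n N L U what θhat) (hC1 : TrueParameter P ψ Θ θ₀)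
    (hC2 : WellPosed μ ψ f Θ n N L U what) (hC3 : SecondMoments P ψ f Θ w)
    (hC4 : IIDSamples μ P L U) (hS : LocallySmooth P ψ f Θ θ₀) {c δ : ℝ} (hc : 0 < c)
    (hδ : 0 < δ) :
    HighProb μ (fun k ω => ‖θhat k ω - θ₀‖ ≤ δ ∧
      ‖estFun ψ f (n k) (N k) (fun i => L i ω) (fun j => U j ω) (what k ω) θ₀
        + Matrix.toEuclideanCLM (𝕜 := ℝ) (matA P ψ θ₀) (θhat k ω - θ₀)‖
          ≤ c * ‖θhat k ω - θ₀‖) := by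
  set A := Matrix.toEuclideanCLM (𝕜 := ℝ) (matA P ψ θ₀) with hA
  set B := Matrix.toEuclideanCLM (𝕜 := ℝ) (matA P ψ θ₀)⁻¹ with hB
  -- The bound `c` serves the final expansion, the other one the existence of a zero.
  set c' := min c (1 / (2 * (‖B‖ + 1))) with hc'
  have hc'0 : 0 < c' := by positivity
  obtain ⟨r, hr, hrδ, hrΘ, H⟩ := exists_highProb_estFun_sub_sub_le hψ hf hn hN hw hC4 hS hc'0 hδ
  have hY : Integrable (scoreY ψ θ₀) P :=
    (memLp_scoreY hC3 hC1.mem (hψ θ₀ hC1.mem)).integrable one_le_two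
  have hF : Integrable (scoreF ψ f θ₀) (P.map Prod.snd) := hS.memLp_predicted.integrable one_le_two
  have H0 := highProb_norm_estFun_le hn hN hw hC1 hC4 hY hF
    (c := r / (2 * (‖B‖ + 1))) (by positivity)
  refine ((H.and H0).and (highProb_estFun_eq_zero hest hC2)).mono ?_
  rintro k ω ⟨⟨h1, h2⟩, -, h3, h4⟩
  -- A zero is produced near θ₀ and then identified with the estimator by uniqueness, so no control
  -- of Ψ far from θ₀ is needed.
  obtain ⟨y, hy, hy0⟩ := exists_mem_closedBall_eq_zero
    (toEuclideanCLM_mul_inv_apply hS.nonsingular) hc'0.le hr.le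
    (by
      rw [← le_div_iff₀ (by positivity)]
      exact min_le_right _ _) h1
    (by rwa [← le_div_iff₀ (by positivity)])
  have hyθ := h4 y (hrΘ hy) hy0
  rw [hyθ] at hy
  have hyn : ‖θhat k ω - θ₀‖ ≤ r := by rwa [Metric.mem_closedBall, dist_eq_norm] at hy
  refine ⟨hyn.trans hrδ, ?_⟩
  have h5 := h1 _ hy θ₀ (Metric.mem_closedBall_self hr.le)
  rw [h3, zero_sub, ← neg_add', norm_neg] at h5
  exact h5.trans (by gcongr; exact min_le_left _ _)

/-- Consistency under local smoothness. -/
theorem tendstoInMeasure_estimator_of_locallySmooth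
    (hψ : ∀ θ ∈ Θ, Measurable (fun p : ℝ × Vec d => ψ p.1 p.2 θ))
    (hf : Measurable f) (hn : Tendsto n atTop atTop) (hN : Tendsto N atTop atTop)
    (hw : TendstoInMeasure μ what atTop (fun _ => w))
    (hest : IsEstimator μ ψ f Θ n N L U what θhat) (hC1 : TrueParameter P ψ Θ θ₀)
    (hC2 : WellPosed μ ψ f Θ n N L U what) (hC3 : SecondMoments P ψ f Θ w)
    (hC4 : IIDSamples μ P L U) (hS : LocallySmooth P ψ f Θ θ₀) :
    TendstoInMeasure μ θhat atTop (fun _ => θ₀) := by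
  rw [tendstoInMeasure_iff_highProb]
  intro δ hδ
  refine (highProb_estimator_expansion hψ hf hn hN hw hest hC1 hC2 hC3 hC4 hS one_pos
    (half_pos hδ)).mono fun k ω h => ?_
  rw [dist_eq_norm]
  linarith [h.1]

lemma average_map {S E F : Type*} [NormedAddCommGroup E] [NormedSpace ℝ E]
    [NormedAddCommGroup F] [NormedSpace ℝ F] (T : E →L[ℝ] F) (m : ℕ) (x : ℕ → S) (g : S → E) :
    average m x (fun p => T (g p)) = T (average m x g) := by
  simp [average, map_sum]

lemma average_sub {S E : Type*} [AddCommGroup E] [Module ℝ E] (m : ℕ) (x : ℕ → S) (g h : S → E) :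
    average m x (fun p => g p - h p) = average m x g - average m x h := by
  simp [average, smul_sub]

/-- The normalized difference of the two averages of the predicted scores is asymptotically
normal. -/
lemma tendstoInDistribution_average_sub_average
    (hψ : Measurable (fun p : ℝ × Vec d => ψ p.1 p.2 θ₀)) (hf : Measurable f)
    (hn : Tendsto n atTop atTop) (hN : Tendsto N atTop atTop) {ρ : ℝ}
    (hρ : Tendsto (fun k => (n k : ℝ) / (N k : ℝ)) atTop (𝓝 ρ)) (hC4 : IIDSamples μ P L U)
    (hF : MemLp (scoreF ψ f θ₀) 2 (P.map Prod.snd)) :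
    ∃ M : Matrix (Fin q) (Fin q) ℝ, TendstoInDistribution
      (fun k ω => √(n k : ℝ) • (-average (n k) (fun i => (L i ω).2) (scoreF ψ f θ₀)
        + average (N k) (fun j => U j ω) (scoreF ψ f θ₀))) atTop id
      (fun _ => μ) (multivariateGaussian 0 M) := by
  have hρ0 : 0 ≤ ρ := ge_of_tendsto' hρ fun k => by positivity
  -- Both samples of (X, Z) have the same law: the labeled one contributes `C` and the unlabeled one
  -- `ρ • C`. Only boundedness in probability is used later, so the limit covariance stays
  -- existential.
  set C := covMatrix (P.map Prod.snd) (scoreF ψ f θ₀) (scoreF ψ f θ₀) with hC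
  have hm := measurable_scoreF hψ hf
  have hquad : ∀ t : Vec q, t.ofLp ⬝ᵥ (C + ρ • C).mulVec t.ofLp =
      Var[fun p => inner ℝ (-scoreF ψ f θ₀ p) t; P.map Prod.snd]
        + ρ * Var[fun p => inner ℝ (scoreF ψ f θ₀ p) t; P.map Prod.snd] := by
    intro t
    simp only [inner_neg_left]
    rw [variance_fun_neg, Matrix.add_mulVec, Matrix.smul_mulVec, dotProduct_add, dotProduct_smul,
      hC, dotProduct_covMatrix_mulVec hF hF,
      covariance_self (hF.inner_const t).aestronglyMeasurable.aemeasurable, smul_eq_mul]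
  have hpsd : (C + ρ • C).PosSemidef := by
    refine .of_dotProduct_mulVec_nonneg ?_ fun x => ?_
    · rw [Matrix.IsHermitian, Matrix.conjTranspose_eq_transpose_of_trivial]
      simp [hC, covMatrix_transpose]
    · rw [star_trivial]
      have := hquad (WithLp.toLp 2 x)
      rw [this]
      exact add_nonneg (variance_nonneg _ _) (mul_nonneg hρ0 (variance_nonneg _ _))
  have hindep : IndepFun (fun ω i => (L i ω).2) (fun ω j => U j ω) μ :=
    hC4.indep_samples.comp (φ := fun (l : ℕ → ℝ × Vec d × Z) i => (l i).2) (ψ := id)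
      (by fun_prop) measurable_id
  refine ⟨C + ρ • C, ?_⟩
  have key := tendstoInDistribution_twoSample hC4.law_labeled_snd hC4.indep_labeled_snd
    hC4.law_unlabeled hC4.indep_unlabeled hindep hn hN hρ hm.neg hm hF.neg hF hpsd hquad
  convert key using 3 with k ω
  congr 1
  have e1 : average (n k) (fun i => (L i ω).2) (-scoreF ψ f θ₀)
      = -average (n k) (fun i => (L i ω).2) (scoreF ψ f θ₀) := by
    simp [average]
  have e2 : ∫ p, (-scoreF ψ f θ₀) p ∂(P.map Prod.snd)
      = -∫ p, scoreF ψ f θ₀ p ∂(P.map Prod.snd) := integral_neg _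
  rw [e1, e2]
  abel

/-- The leading term of the expansion of the estimator is asymptotically normal. -/
lemma tendstoInDistribution_linearized
    (hψ : Measurable (fun p : ℝ × Vec d => ψ p.1 p.2 θ₀)) (hf : Measurable f)
    (hn : Tendsto n atTop atTop) (hN : Tendsto N atTop atTop) {ρ : ℝ}
    (hρ : Tendsto (fun k => (n k : ℝ) / (N k : ℝ)) atTop (𝓝 ρ)) (hC4 : IIDSamples μ P L U)
    (hY0 : ∫ p, scoreY ψ θ₀ p ∂P = 0) (hY : MemLp (scoreY ψ θ₀) 2 P)
    (hF : MemLp (scoreF ψ f θ₀) 2 (P.map Prod.snd)) (w : Vec q) :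
    TendstoInDistribution (fun k ω => √(n k : ℝ) •
      -Matrix.toEuclideanCLM (𝕜 := ℝ) (matA P ψ θ₀)⁻¹
        (estFun ψ f (n k) (N k) (fun i => L i ω) (fun j => U j ω) w θ₀)) atTop id
      (fun _ => μ) (multivariateGaussian 0 (matSigma P ψ f ρ w θ₀)) := by
  have hρ0 : 0 ≤ ρ := ge_of_tendsto' hρ fun k => by positivity
  set B := Matrix.toEuclideanCLM (𝕜 := ℝ) (matA P ψ θ₀)⁻¹ with hB
  have hF' : MemLp (fun p : ℝ × Vec d × Z => scoreF ψ f θ₀ p.2) 2 P :=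
    hF.comp_of_map measurable_snd.aemeasurable
  have hmY : Measurable (scoreY (Z := Z) ψ θ₀) := measurable_scoreY hψ
  have hmF := measurable_scoreF hψ hf
  have hmF' : Measurable (fun p : ℝ × Vec d × Z => scoreF ψ f θ₀ p.2) := hmF.comp measurable_snd
  have hdF' : MemLp (fun p : ℝ × Vec d × Z => diagCLM w (scoreF ψ f θ₀ p.2)) 2 P :=
    (diagCLM w).comp_memLp' hF'
  -- Both scores of a labeled point enter one summand, whence the covariance M₄; the unlabeled
  -- sample enters independently.
  have key := tendstoInDistribution_twoSample (g := fun p => (-B) (scoreY ψ θ₀ p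
      - diagCLM w (scoreF ψ f θ₀ p.2))) (h := fun v => (-B) (diagCLM w (scoreF ψ f θ₀ v)))
    hC4.law_labeled hC4.indep_labeled hC4.law_unlabeled hC4.indep_unlabeled hC4.indep_samples
    hn hN hρ (by fun_prop) (by fun_prop) ((-B).comp_memLp' (hY.sub hdF'))
    ((-B).comp_memLp' ((diagCLM w).comp_memLp' hF)) (posSemidef_matSigma (w := w) hρ0 hY hF)
    (dotProduct_matSigma_mulVec hY hF)
  convert key using 3 with k ω
  congr 1
  have iY := hY.integrable one_le_two
  have iF := hF.integrable one_le_two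
  have idF' := hdF'.integrable one_le_two
  have iF' := hF'.integrable one_le_two
  have isub : Integrable (fun p => scoreY ψ θ₀ p - diagCLM w (scoreF ψ f θ₀ p.2)) P := iY.sub idF'
  have e0 : ∫ p, scoreF ψ f θ₀ p.2 ∂P = ∫ v, scoreF ψ f θ₀ v ∂(P.map Prod.snd) :=
    (integral_map measurable_snd.aemeasurable hF.1).symm
  -- The outcome score has mean zero and the predicted means agree, so the two centering terms
  -- cancel.
  have e1 : ∫ p, (-B) (scoreY ψ θ₀ p - diagCLM w (scoreF ψ f θ₀ p.2)) ∂P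
      = -∫ v, (-B) (diagCLM w (scoreF ψ f θ₀ v)) ∂(P.map Prod.snd) := by
    rw [(-B).integral_comp_comm isub, (-B).integral_comp_comm ((diagCLM w).integrable_comp
      iF), (diagCLM w).integral_comp_comm iF, integral_sub iY idF', hY0,
      (diagCLM w).integral_comp_comm iF', e0, zero_sub, map_neg]
  rw [e1, average_map, average_map, average_sub, average_map, average_map, estFun_eq,
    ← diagCLM_apply]
  have e2 : average (n k) (fun i => L i ω) (fun p : ℝ × Vec d × Z => scoreF ψ f θ₀ p.2)
      = average (n k) (fun i => (L i ω).2) (scoreF ψ f θ₀) := rfl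
  rw [e2]
  simp only [map_add, map_sub, map_neg, _root_.neg_apply]
  abel

/-- Asymptotic normality of the estimator. -/
theorem tendstoInDistribution_estimator
    (hψ : ∀ θ ∈ Θ, Measurable (fun p : ℝ × Vec d => ψ p.1 p.2 θ))
    (hf : Measurable f) (hn : Tendsto n atTop atTop) (hN : Tendsto N atTop atTop) {ρ : ℝ}
    (hρ : Tendsto (fun k => (n k : ℝ) / (N k : ℝ)) atTop (𝓝 ρ))
    (hw : TendstoInMeasure μ what atTop (fun _ => w)) (hθhat : ∀ k, Measurable (θhat k))
    (hest : IsEstimator μ ψ f Θ n N L U what θhat) (hC1 : TrueParameter P ψ Θ θ₀)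
    (hC2 : WellPosed μ ψ f Θ n N L U what) (hC3 : SecondMoments P ψ f Θ w)
    (hC4 : IIDSamples μ P L U) (hS : LocallySmooth P ψ f Θ θ₀) :
    TendstoInDistribution (fun k ω => √(n k : ℝ) • (θhat k ω - θ₀)) atTop id
      (fun _ => μ) (multivariateGaussian 0 (matSigma P ψ f ρ w θ₀)) := by
  set B := Matrix.toEuclideanCLM (𝕜 := ℝ) (matA P ψ θ₀)⁻¹ with hB
  have hlin := tendstoInDistribution_linearized (hψ θ₀ hC1.mem) hf hn hN hρ hC4
    ((hC1.unique θ₀ hC1.mem).2 rfl) (memLp_scoreY hC3 hC1.mem (hψ θ₀ hC1.mem))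
    hS.memLp_predicted w
  obtain ⟨M, hM⟩ := tendstoInDistribution_average_sub_average (hψ θ₀ hC1.mem) hf hn hN hρ hC4
    hS.memLp_predicted
  set Ψ : ℕ → Ω → Vec q → Vec q := fun k ω v =>
    estFun ψ f (n k) (N k) (fun i => L i ω) (fun j => U j ω) v θ₀ with hΨ
  -- Ψ is affine in the weights, so the change is diag(what − w) applied to the difference of
  -- predicted averages, which is bounded in probability after scaling by √n.
  have hplug : TendstoInMeasure μ
      (fun k ω => √(n k : ℝ) • B (Ψ k ω (what k ω) - Ψ k ω w)) atTop 0 := by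
    refine tendstoInMeasure_zero_of_norm_le_mul hM fun η hη => ?_
    refine (tendstoInMeasure_iff_highProb.1 hw (η / (‖B‖ + 1)) (by positivity)).mono fun k ω h => ?_
    rw [dist_eq_norm] at h
    set D := -average (n k) (fun i => (L i ω).2) (scoreF ψ f θ₀)
        + average (N k) (fun j => U j ω) (scoreF ψ f θ₀)
    have e : Ψ k ω (what k ω) - Ψ k ω w = diagMul (what k ω - w) D := by
      simp only [hΨ, estFun_eq, diagMul_sub_left]
      abel
    rw [e, norm_smul, norm_smul]
    have h1 : ‖B (diagMul (what k ω - w) D)‖ ≤ η * ‖D‖ := by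
      calc ‖B (diagMul (what k ω - w) D)‖ ≤ ‖B‖ * (‖what k ω - w‖ * ‖D‖) :=
            (B.le_opNorm _).trans (by gcongr; exact norm_diagMul_le _ _)
        _ ≤ (‖B‖ + 1) * (η / (‖B‖ + 1) * ‖D‖) := by gcongr; linarith
        _ = η * ‖D‖ := by field_simp
    calc ‖√(n k : ℝ)‖ * ‖B (diagMul (what k ω - w) D)‖ ≤ ‖√(n k : ℝ)‖ * (η * ‖D‖) := by gcongr
      _ ≤ η * (‖√(n k : ℝ)‖ * ‖D‖ + 1) := by linarith
  have hrem : TendstoInMeasure μ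
      (fun k ω => √(n k : ℝ) • (θhat k ω - θ₀ + B (Ψ k ω (what k ω)))) atTop 0 := by
    refine tendstoInMeasure_zero_of_norm_le_mul hlin fun η hη => ?_
    -- The bound by 1 lets ‖x‖ be absorbed into 2‖Bp‖; the bound by `η` makes the remainder at most
    -- η‖Bp‖.
    set c := min 1 η / (2 * (‖B‖ + 1)) with hc
    have hc0 : 0 < c := by positivity
    refine ((highProb_estimator_expansion hψ hf hn hN hw hest hC1 hC2 hC3 hC4 hS hc0
      one_pos).and (tendstoInMeasure_iff_highProb.1 hplug 1 one_pos)).mono ?_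
    rintro k ω ⟨⟨-, h1⟩, h2⟩
    set x := θhat k ω - θ₀
    set p := Ψ k ω (what k ω)
    set p' := Ψ k ω w
    rw [Pi.zero_apply, dist_zero_right, map_sub] at h2
    have h3 : ‖x + B p‖ ≤ min 1 η / 2 * ‖x‖ := by
      have e : x + B p = B (p + Matrix.toEuclideanCLM (𝕜 := ℝ) (matA P ψ θ₀) x) := by
        rw [map_add, toEuclideanCLM_inv_mul_apply hS.nonsingular, add_comm]
      rw [e]
      calc _ ≤ ‖B‖ * (c * ‖x‖) := (B.le_opNorm _).trans (by gcongr)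
        _ ≤ (‖B‖ + 1) * (c * ‖x‖) := by gcongr; linarith
        _ = min 1 η / 2 * ‖x‖ := by rw [hc]; field_simp
    have h4 : ‖x‖ ≤ 2 * ‖B p‖ := by
      have h5 : ‖x‖ ≤ ‖x + B p‖ + ‖B p‖ := by simpa using norm_sub_le (x + B p) (B p)
      have h6 : min 1 η / 2 * ‖x‖ ≤ 1 / 2 * ‖x‖ := by gcongr; exact min_le_left _ _
      linarith
    have h7 : ‖x + B p‖ ≤ η * ‖B p‖ := by
      refine h3.trans ?_
      calc min 1 η / 2 * ‖x‖ ≤ η / 2 * (2 * ‖B p‖) := by gcongr; exact min_le_right _ _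
        _ = η * ‖B p‖ := by ring
    -- By `hplug`, passing to the limiting weights costs at most 1, which is the `+ 1` allowed in
    -- `tendstoInMeasure_zero_of_norm_le_mul`.
    have h8 : ‖√(n k : ℝ) • B p‖ ≤ ‖√(n k : ℝ) • -B p'‖ + 1 := by
      have e : √(n k : ℝ) • B p = √(n k : ℝ) • (B p - B p') - √(n k : ℝ) • -B p' := by
        rw [← smul_sub]
        congr 1
        abel
      rw [e]
      exact (norm_sub_le _ _).trans (by linarith)
    calc ‖√(n k : ℝ) • (x + B p)‖ = ‖√(n k : ℝ)‖ * ‖x + B p‖ := norm_smul _ _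
      _ ≤ ‖√(n k : ℝ)‖ * (η * ‖B p‖) := by gcongr
      _ = η * ‖√(n k : ℝ) • B p‖ := by rw [norm_smul]; ring
      _ ≤ η * (‖√(n k : ℝ) • -B p'‖ + 1) := by gcongr
  refine tendstoInDistribution_of_tendstoInMeasure_sub _ _ hlin ?_ fun k => ?_
  · rw [tendstoInMeasure_iff_highProb]
    intro δ hδ
    refine ((tendstoInMeasure_iff_highProb.1 hrem (δ / 2) (half_pos hδ)).and
      (tendstoInMeasure_iff_highProb.1 hplug (δ / 2) (half_pos hδ))).mono ?_
    rintro k ω ⟨h1, h2⟩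
    rw [Pi.zero_apply, dist_zero_right] at h1 h2 ⊢
    have e : ((fun k ω => √(n k : ℝ) • (θhat k ω - θ₀))
        - fun k ω => √(n k : ℝ) • -B (Ψ k ω w)) k ω
        = √(n k : ℝ) • (θhat k ω - θ₀ + B (Ψ k ω (what k ω)))
          - √(n k : ℝ) • B (Ψ k ω (what k ω) - Ψ k ω w) := by
      simp only [Pi.sub_apply]
      rw [← smul_sub, ← smul_sub, map_sub]
      congr 1
      abel
    rw [e]
    exact (norm_sub_le _ _).trans_lt (by linarith)
  · have := hθhat k
    fun_prop

end Normality

end PSPA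

theorem corollary1 {d q : ℕ} {Z : Type*} [MeasurableSpace Z]
    {Ω : Type*} [MeasurableSpace Ω] (μ : Measure Ω) [IsProbabilityMeasure μ]
    (P : Measure (ℝ × PSPA.Vec d × Z)) [IsProbabilityMeasure P]
    (ψ : ℝ → PSPA.Vec d → PSPA.Vec q → PSPA.Vec q) (f : Z → ℝ)
    (Θ : Set (PSPA.Vec q)) (θ₀ : PSPA.Vec q)
    (hψ : ∀ θ ∈ Θ, Measurable (fun p : ℝ × PSPA.Vec d => ψ p.1 p.2 θ))
    (hf : Measurable f)
    -- the data, the sample sizes and the weights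
    (L : ℕ → Ω → ℝ × PSPA.Vec d × Z) (U : ℕ → Ω → PSPA.Vec d × Z)
    (n N : ℕ → ℕ) (hn : Tendsto n atTop atTop) (hN : Tendsto N atTop atTop)
    (ρ : ℝ) (hρ : Tendsto (fun k => (n k : ℝ) / (N k : ℝ)) atTop (𝓝 ρ))
    (w : PSPA.Vec q) (what : ℕ → Ω → PSPA.Vec q) (hwhat : ∀ k, Measurable (what k))
    (hw : TendstoInMeasure μ what atTop (fun _ => w))
    -- the estimator with the estimated weights plugged in
    (θhat : ℕ → Ω → PSPA.Vec q) (hθhat : ∀ k, Measurable (θhat k))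
    (hest : PSPA.IsEstimator μ ψ f Θ n N L U what θhat)
    (hC1 : PSPA.TrueParameter P ψ Θ θ₀)
    (hC2 : PSPA.WellPosed μ ψ f Θ n N L U what)
    (hC3 : PSPA.SecondMoments P ψ f Θ w)
    (hC4 : PSPA.IIDSamples μ P L U) :
    (PSPA.Dominated P ψ f Θ → TendstoInMeasure μ θhat atTop (fun _ => θ₀)) ∧
    (PSPA.LocallySmooth P ψ f Θ θ₀ →
      TendstoInMeasure μ θhat atTop (fun _ => θ₀) ∧
      (PSPA.matSigma P ψ f ρ w θ₀).PosSemidef ∧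
      TendstoInDistribution (fun k ω => √(n k : ℝ) • (θhat k ω - θ₀)) atTop id
        (fun _ => μ) (multivariateGaussian 0 (PSPA.matSigma P ψ f ρ w θ₀))) := by
  refine ⟨fun hD => PSPA.tendstoInMeasure_estimator_of_dominated hψ hf hn hN hw hest hC1 hC2 hC4 hD,
    fun hS => ⟨PSPA.tendstoInMeasure_estimator_of_locallySmooth hψ hf hn hN hw hest hC1 hC2 hC3 hC4
      hS, ?_, PSPA.tendstoInDistribution_estimator hψ hf hn hN hρ hw hθhat hest hC1 hC2 hC3 hC4 hS⟩⟩
  exact PSPA.posSemidef_matSigma (ge_of_tendsto' hρ fun k => by positivity)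
    (PSPA.memLp_scoreY hC3 hC1.mem (hψ θ₀ hC1.mem)) hS.memLp_predicted
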